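/- **Theorem (Jensen theorem).** Let $\mathbb H$ be the quaternions, $\mathbb S=\{I\in\mathbb H:\operatorname{Re} I=0,\ |I|=1\}$, $\mathbb C_I=\mathbb R+I\mathbb R$ for $I\in\mathbb S$, $B(0;R)=\{|q|<R\}$, and $[x+Iy]=\{x+Jy: J\in\mathbb S\}$. A function $f$ on an open set $U\subseteq\mathbb H$ is *slice regular* if it is real differentiable and $\frac12(\partial_x+I\partial_y)f(x+Iy)=0$ on $U\cap\mathbb C_I$ for every $I\in\mathbb S$; it is *intrinsic* if moreover $f(U\cap\mathbb C_I)\subseteq\mathbb C_I$ for every $I\in\mathbb S$. A slice regular $f$ on a ball centred at $0$ has the form $f(x+Iy)=\alpha(x,y)+I\beta(x,y)$, with $\alpha,\beta$ independent of $I$. For $f=\alpha+I\beta$ and $g=\gamma+I\delta$ put $f\star g=(\alpha\gamma-\beta\delta)+I(\alpha\delta+\beta\gamma)$, $f^c=\overline\alpha+I\overline\beta$, and $f^s=f\star f^c$ (the symmetrization). Let $f\not\equiv 0$ be slice regular on $B(0;R)$. The *spherical multiplicity* of $f$ at a sphere $[x+Iy]\subset B(0;R)$, $y\neq0$, is the largest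 $m$ such that $f(q)=[(q-x)^2+y^2]^m g(q)$ with $g$ slice regular on $B(0;R)$ and not identically zero on $[x+Iy]$. The *isolated multiplicity* of $f$ at a real point $a$ is the largest $r$ such that $f(q)=(q-a)^r g(q)$ with $g$ slice regular and $g(a)\ne0$; at a nonreal point $a=x+Iy$ it is the largest $r\ge1$ such that $$f(q)=(q-q_1)\star\cdots\star(q-q_r)\star[(q-x)^2+y^2]^m g(q)$$ for some $m\ge 0$, with $q_1=a$, $q_2,\dots,q_r\in[a]$, $q_\ell\neq\overline{q_{\ell+1}}$ for $1\le\ell<r$, and $g$ slice regular on $B(0;R)$ without zeros on $[a]$ (and $0$ if there is no such $r$). For $t\le R$ let $n_f(t)$ be the number of zeros of $f$ in $|q|<t$: the sum of the isolated multiplicities at all points of that ball plus twice the sum of the spherical multiplicities at all its spheres. Let $R>0$, let $f$ be slice regular on an open set containing $\overline{B(0;R)}$, and assume $f(0)\neq0$. Let $f=gh$ (pointwise product) on $B(0;R)$, where $g,h$ are slice regular in $B(0;R)$ and continuous on $\overline{B(0;R)}$, $g$ is intrinsic and has at most spherical zeros in $B(0;R)$ (a real zero being regarded as a degenerate sphere),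 and $h$ has at most isolated zeros in $B(0;R)$. Then for every $I\in\mathbb S$ $$\int_0^R\frac{n_f(t)}{t}\,dt=\left(\frac1{2\pi}\int_0^{2\pi}\log|g(Re^{I\theta})|\,d\theta-\log|g(0)|\right)+\frac12\left(\frac1{2\pi}\int_0^{2\pi}\log|h^s(Re^{I\theta})|\,d\theta-\log|h^s(0)|\right),$$ where all three integrals exist as Lebesgue integrals of integrable functions. -/

import Mathlib

open scoped Quaternion

noncomputable section

namespace SliceRegular

/-- The sphere `𝕊` of quaternionic imaginary units. -/
def imagUnits : Set ℍ[ℝ] := {I | I.re = 0 ∧ ‖I‖ = 1}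

/-- The imaginary unit `i`. -/
def unitI : ℍ[ℝ] := ⟨0, 1, 0, 0⟩

/-- The quaternion `x + I y`. -/
def pt (I : ℍ[ℝ]) (x y : ℝ) : ℍ[ℝ] := (x : ℍ[ℝ]) + I * (y : ℍ[ℝ])

/-- The sphere `[x + I y] = x + 𝕊 y`; it is the single point `x` when `y = 0`. -/
def sphereAt (x y : ℝ) : Set ℍ[ℝ] := {p | ∃ J ∈ imagUnits, p = pt J x y}

/-- The sphere `[q]` of a quaternion `q`. -/
def sphereOf (q : ℍ[ℝ]) : Set ℍ[ℝ] := sphereAt q.re ‖q.im‖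

/-- (Left) slice regular functions on a (open) set `U`: `f` is real differentiable, and
`(∂/∂x + I ∂/∂y) f (x + I y) = 0` on `U ∩ ℂ_I` for every imaginary unit `I`. The partial
derivatives are the values of the real Fréchet derivative in the directions `1` and `I`. -/
def SliceRegularOn (f : ℍ[ℝ] → ℍ[ℝ]) (U : Set ℍ[ℝ]) : Prop :=
  DifferentiableOn ℝ f U ∧
    ∀ I ∈ imagUnits, ∀ x y : ℝ, pt I x y ∈ U →
      (1 / 2 : ℝ) • (fderiv ℝ f (pt I x y) 1 + I * fderiv ℝ f (pt I x y) I) = 0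

/-- Quaternionic intrinsic functions: slice regular functions that map `U ∩ ℂ_I` to `ℂ_I`
for every imaginary unit `I`. -/
def IntrinsicOn (f : ℍ[ℝ] → ℍ[ℝ]) (U : Set ℍ[ℝ]) : Prop :=
  SliceRegularOn f U ∧
    ∀ I ∈ imagUnits, ∀ x y : ℝ, pt I x y ∈ U → ∃ u v : ℝ, f (pt I x y) = pt I u v

/-- The component `α` in `f (x + I y) = α (x, y) + I β (x, y)`. By the representation formula it
may be computed from any imaginary unit; we use `i`. -/
def alpha (f : ℍ[ℝ] → ℍ[ℝ]) (x y : ℝ) : ℍ[ℝ] :=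
  (1 / 2 : ℝ) • (f (pt unitI x y) + f (pt unitI x (-y)))

/-- The component `β` in `f (x + I y) = α (x, y) + I β (x, y)`. -/
def beta (f : ℍ[ℝ] → ℍ[ℝ]) (x y : ℝ) : ℍ[ℝ] :=
  (1 / 2 : ℝ) • (unitI * (f (pt unitI x (-y)) - f (pt unitI x y)))

/-- The slice function `x + I y ↦ a (x, y) + I b (x, y)`. A quaternion `q` is written with
`x = Re q`, `y = |Im q|` and `I = Im q / |Im q|` (for real `q` the term with `I` is dropped; all
the `b` used below vanish for `y = 0`). -/
def induced (a b : ℝ → ℝ → ℍ[ℝ]) (q : ℍ[ℝ]) : ℍ[ℝ] :=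
  a q.re ‖q.im‖ + (‖q.im‖⁻¹ • q.im) * b q.re ‖q.im‖

/-- The slice regular product `f ⋆ g`: if `f = α + I β` and `g = γ + I δ` then
`f ⋆ g = (α γ - β δ) + I (α δ + β γ)`. -/
def starMul (f g : ℍ[ℝ] → ℍ[ℝ]) : ℍ[ℝ] → ℍ[ℝ] :=
  induced (fun x y => alpha f x y * alpha g x y - beta f x y * beta g x y)
    (fun x y => alpha f x y * beta g x y + beta f x y * alpha g x y)

/-- The conjugate function `f^c`: if `f = α + I β` then `f^c = conj α + I conj β`. -/
def conjFun (f : ℍ[ℝ] → ℍ[ℝ]) : ℍ[ℝ] → ℍ[ℝ] :=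
  induced (fun x y => star (alpha f x y)) (fun x y => star (beta f x y))

/-- The symmetrization `f^s = f ⋆ f^c`. -/
def symm (f : ℍ[ℝ] → ℍ[ℝ]) : ℍ[ℝ] → ℍ[ℝ] := starMul f (conjFun f)

/-- The polynomial `(q - x)^2 + y^2`, whose zero set is the sphere `x + 𝕊 y`. Its coefficients
are real, so its powers and its slice regular products from the left are pointwise ones. -/
def sphFactor (x y : ℝ) (q : ℍ[ℝ]) : ℍ[ℝ] := (q - (x : ℍ[ℝ])) ^ 2 + ((y ^ 2 : ℝ) : ℍ[ℝ])

/-- `(q - q₁) ⋆ ⋯ ⋆ (q - q_r) ⋆ g` for a list `[q₁, …, q_r]`. -/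
def starFactors (L : List ℍ[ℝ]) (g : ℍ[ℝ] → ℍ[ℝ]) : ℍ[ℝ] → ℍ[ℝ] :=
  L.foldr (fun a F => starMul (fun q => q - a) F) g

/-- The spherical multiplicity of `f` at the sphere `x + 𝕊 y`, `y ≠ 0`, in an axially symmetric
slice domain `U`: the largest `m` such that `f = [(q - x)^2 + y^2]^m g` with `g` slice
regular on `U` and not identically zero on the sphere. -/
def sphericalMult (f : ℍ[ℝ] → ℍ[ℝ]) (U : Set ℍ[ℝ]) (x y : ℝ) : ℕ :=
  sSup {m : ℕ | ∃ g : ℍ[ℝ] → ℍ[ℝ], SliceRegularOn g U ∧ (∃ p ∈ sphereAt x y, g p ≠ 0) ∧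
    ∀ q ∈ U, f q = sphFactor x y q ^ m * g q}

open Classical in
/-- The isolated multiplicity of `f` at a point `a` of an axially symmetric slice domain `U`.
For real `a` it is the largest `r` such that `f = (q - a)^r g` with `g` slice regular and
`g a ≠ 0`. For nonreal `a` it is the largest `r` such that
`f = (q - q₁) ⋆ ⋯ ⋆ (q - q_r) ⋆ [(q - x)^2 + y^2]^m g`, where `q₁ = a`, all `q_l` lie on the
sphere `[a] = x + 𝕊 y`, `q_l ≠ conj q_{l+1}`, and `g` is slice regular without zeros
on `[a]`; it is `0` if there is no such `r ≥ 1`. -/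
def isolatedMult (f : ℍ[ℝ] → ℍ[ℝ]) (U : Set ℍ[ℝ]) (a : ℍ[ℝ]) : ℕ :=
  if a.im = 0 then
    sSup {r : ℕ | ∃ g : ℍ[ℝ] → ℍ[ℝ], SliceRegularOn g U ∧ g a ≠ 0 ∧
      ∀ q ∈ U, f q = (q - a) ^ r * g q}
  else
    sSup {r : ℕ | ∃ (L : List ℍ[ℝ]) (m : ℕ) (g : ℍ[ℝ] → ℍ[ℝ]),
      (a :: L).length = r ∧ (∀ p ∈ L, p ∈ sphereOf a) ∧
      List.IsChain (fun p p' => star p' ≠ p) (a :: L) ∧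
      SliceRegularOn g U ∧ (∀ p ∈ sphereOf a, g p ≠ 0) ∧
      ∀ q ∈ U, f q = starFactors (a :: L) (fun p => sphFactor a.re ‖a.im‖ p ^ m * g p) q}

/-- The number `n_f(t)` of zeros of `f` in the ball `|q| < t`, `t ≤ R`, for `f` slice regular on
`B(0; R)`: isolated zeros are counted with their isolated multiplicities, and every
sphere `x + 𝕊 y`, `y > 0`, counts for twice its spherical multiplicity. -/
def zeroCount (f : ℍ[ℝ] → ℍ[ℝ]) (R t : ℝ) : ℕ :=
  (∑ᶠ a ∈ Metric.ball (0 : ℍ[ℝ]) t, isolatedMult f (Metric.ball 0 R) a) +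
    2 * ∑ᶠ p ∈ {p : ℝ × ℝ | 0 < p.2 ∧ pt unitI p.1 p.2 ∈ Metric.ball (0 : ℍ[ℝ]) t},
      sphericalMult f (Metric.ball 0 R) p.1 p.2

/-- The point `R e^{I θ} = R cos θ + I R sin θ`. -/
def circlePt (I : ℍ[ℝ]) (R θ : ℝ) : ℍ[ℝ] := pt I (R * Real.cos θ) (R * Real.sin θ)

/-- All zeros of `g` in `U` are spherical: with a zero `q` the function vanishes on the whole of
`[q]` (which is a single point for real `q`). -/
def OnlySphericalZeros (g : ℍ[ℝ] → ℍ[ℝ]) (U : Set ℍ[ℝ]) : Prop :=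
  ∀ q ∈ U, g q = 0 → ∀ p ∈ sphereOf q, g p = 0

/-- All zeros of `h` in `U` are isolated points of its zero set. -/
def OnlyIsolatedZeros (h : ℍ[ℝ] → ℍ[ℝ]) (U : Set ℍ[ℝ]) : Prop :=
  ∀ q ∈ U, h q = 0 → ∀ᶠ p in nhdsWithin q {q}ᶜ, h p ≠ 0

end SliceRegular

end

noncomputable section

namespace SliceRegular

/-! Replacing the variable unit `I` by a central `i` turns `f = α + I β` into its stem function `F =
α + i β`, with values in the complexified quaternions `ℍ[ℂ]`. Slice regularity makes `F` holomorphic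
with `F (conj z) = cconj (F z)`, the star product becomes ordinary multiplication, and `f^s` becomes
the complex-valued norm form `N = normSq F` (`stemNorm`). Since `normSq` is multiplicative, zeros of
`f` can be counted as zeros of `N`, and the theorem reduces to Jensen's formula for one holomorphic
function.

Locally, `f` factors along a nonreal sphere into linear factors, a power of the quadratic of the
sphere, and a factor without zeros there (`exists_isNormalForm`). The norm form of a linear factor
is one quadratic and that of the quadratic is its square, so `N` has order "isolated + 2 ·
spherical" at both `ζ` and `conj ζ`. At a real zero its order is twice the isolated multiplicity.
Hence `2 n_f(t)` is the number of zeros of `N` in `|z| < t` (`two_mul_zeroCount`).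

Jensen's formula for `N` gives half of `mean log |N| - log |N(0)|` (`integral_zeroCount`). The stem
function of an intrinsic `g` is a complex scalar `γ`, so `f = g h` gives `N(f) = γ² N(h)`
(`stemNorm_mul_of_intrinsic`). Taking logarithms splits the mean into the `g` and `h^s` parts. -/

/-- The element `a + i b` of the complexified quaternions. -/
def cx (a b : ℍ[ℝ]) : ℍ[ℂ] :=
  ⟨⟨a.re, b.re⟩, ⟨a.imI, b.imI⟩, ⟨a.imJ, b.imJ⟩, ⟨a.imK, b.imK⟩⟩

/-- The real part `a` of `a + i b`. -/
def rePart (w : ℍ[ℂ]) : ℍ[ℝ] := ⟨w.re.re, w.imI.re, w.imJ.re, w.imK.re⟩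

/-- The imaginary part `b` of `a + i b`. -/
def imPart (w : ℍ[ℂ]) : ℍ[ℝ] := ⟨w.re.im, w.imI.im, w.imJ.im, w.imK.im⟩

/-- The conjugation `a + i b ↦ a - i b`. -/
def cconj (w : ℍ[ℂ]) : ℍ[ℂ] := cx (rePart w) (-imPart w)

/-- The evaluation `a + i b ↦ a + J b`. -/
def ev (J : ℍ[ℝ]) (w : ℍ[ℂ]) : ℍ[ℝ] := rePart w + J * imPart w

/-- The stem function of `f`. -/
def stem (f : ℍ[ℝ] → ℍ[ℝ]) (z : ℂ) : ℍ[ℂ] := cx (alpha f z.re z.im) (beta f z.re z.im)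

/-- The complex norm form of the stem function; it represents the symmetrization. -/
def stemNorm (f : ℍ[ℝ] → ℍ[ℝ]) (z : ℂ) : ℂ := Quaternion.normSq (stem f z)

/-! ### Algebra of the complexified quaternions -/

@[simp] lemma cx_re (a b : ℍ[ℝ]) : (cx a b).re = ⟨a.re, b.re⟩ := rfl
@[simp] lemma cx_imI (a b : ℍ[ℝ]) : (cx a b).imI = ⟨a.imI, b.imI⟩ := rfl
@[simp] lemma cx_imJ (a b : ℍ[ℝ]) : (cx a b).imJ = ⟨a.imJ, b.imJ⟩ := rfl
@[simp] lemma cx_imK (a b : ℍ[ℝ]) : (cx a b).imK = ⟨a.imK, b.imK⟩ := rfl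
@[simp] lemma rePart_re (w : ℍ[ℂ]) : (rePart w).re = w.re.re := rfl
@[simp] lemma rePart_imI (w : ℍ[ℂ]) : (rePart w).imI = w.imI.re := rfl
@[simp] lemma rePart_imJ (w : ℍ[ℂ]) : (rePart w).imJ = w.imJ.re := rfl
@[simp] lemma rePart_imK (w : ℍ[ℂ]) : (rePart w).imK = w.imK.re := rfl
@[simp] lemma imPart_re (w : ℍ[ℂ]) : (imPart w).re = w.re.im := rfl
@[simp] lemma imPart_imI (w : ℍ[ℂ]) : (imPart w).imI = w.imI.im := rfl
@[simp] lemma imPart_imJ (w : ℍ[ℂ]) : (imPart w).imJ = w.imJ.im := rfl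
@[simp] lemma imPart_imK (w : ℍ[ℂ]) : (imPart w).imK = w.imK.im := rfl
@[simp] lemma rePart_cx (a b : ℍ[ℝ]) : rePart (cx a b) = a := rfl
@[simp] lemma imPart_cx (a b : ℍ[ℝ]) : imPart (cx a b) = b := rfl
@[simp] lemma cx_rePart_imPart (w : ℍ[ℂ]) : cx (rePart w) (imPart w) = w := rfl

lemma cx_mul (a b c d : ℍ[ℝ]) : cx a b * cx c d = cx (a * c - b * d) (a * d + b * c) := by
  ext <;> apply Complex.ext <;> simp <;> ring

lemma cconj_cx (a b : ℍ[ℝ]) : cconj (cx a b) = cx a (-b) := rfl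

lemma cconj_mul (v w : ℍ[ℂ]) : cconj (v * w) = cconj v * cconj w := by
  rw [← cx_rePart_imPart v, ← cx_rePart_imPart w, cx_mul]
  simp only [cconj_cx, cx_mul]
  congr 1 <;> noncomm_ring

lemma cconj_cconj (w : ℍ[ℂ]) : cconj (cconj w) = w := by
  simp [cconj]

lemma cx_zero : cx 0 0 = 0 := by ext <;> apply Complex.ext <;> simp

/-! ### Imaginary units, slices and spheres -/

lemma mul_self_of_mem_imagUnits {J : ℍ[ℝ]} (hJ : J ∈ imagUnits) : J * J = -1 := by
  rw [← sq, Quaternion.sq_eq_neg_normSq.2 hJ.1, Quaternion.normSq_eq_norm_mul_self, hJ.2]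
  simp

lemma star_of_mem_imagUnits {J : ℍ[ℝ]} (hJ : J ∈ imagUnits) : star J = -J := by
  have := hJ.1
  ext <;> simp [this]

lemma neg_mem_imagUnits {J : ℍ[ℝ]} (hJ : J ∈ imagUnits) : -J ∈ imagUnits := by
  refine ⟨by simp [hJ.1], by simp [hJ.2]⟩

lemma mem_imagUnits_of_sq {J : ℍ[ℝ]} (h0 : J.re = 0)
    (h1 : J.imI ^ 2 + J.imJ ^ 2 + J.imK ^ 2 = 1) : J ∈ imagUnits := by
  refine ⟨h0, ?_⟩
  have h2 := Quaternion.normSq_eq_norm_mul_self J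
  rw [Quaternion.normSq_def', h0] at h2
  nlinarith [norm_nonneg J]

lemma sq_of_mem_imagUnits {J : ℍ[ℝ]} (hJ : J ∈ imagUnits) :
    J.imI ^ 2 + J.imJ ^ 2 + J.imK ^ 2 = 1 := by
  have h2 := Quaternion.normSq_eq_norm_mul_self J
  rw [Quaternion.normSq_def', hJ.1, hJ.2] at h2
  linarith

lemma unitI_mem : unitI ∈ imagUnits := mem_imagUnits_of_sq rfl (by simp [unitI])

@[simp] lemma pt_re {J : ℍ[ℝ]} (hJ : J ∈ imagUnits) (x y : ℝ) : (pt J x y).re = x := by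
  simp [pt, hJ.1]

lemma pt_im {J : ℍ[ℝ]} (hJ : J ∈ imagUnits) (x y : ℝ) : (pt J x y).im = y • J := by
  have := hJ.1
  ext <;> simp [pt, this, mul_comm]

lemma norm_pt_im {J : ℍ[ℝ]} (hJ : J ∈ imagUnits) (x y : ℝ) : ‖(pt J x y).im‖ = |y| := by
  rw [pt_im hJ, norm_smul, hJ.2, mul_one, Real.norm_eq_abs]

lemma norm_pt {J : ℍ[ℝ]} (hJ : J ∈ imagUnits) (x y : ℝ) : ‖pt J x y‖ = ‖(⟨x, y⟩ : ℂ)‖ := by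
  have h := sq_of_mem_imagUnits hJ
  have h0 := hJ.1
  have h1 := Quaternion.normSq_eq_norm_mul_self (pt J x y)
  have h2 := Complex.normSq_eq_norm_sq (⟨x, y⟩ : ℂ)
  rw [Complex.normSq_mk] at h2
  rw [Quaternion.normSq_def'] at h1
  have e : (pt J x y).re ^ 2 + (pt J x y).imI ^ 2 + (pt J x y).imJ ^ 2 + (pt J x y).imK ^ 2 =
      x ^ 2 + y ^ 2 * (J.imI ^ 2 + J.imJ ^ 2 + J.imK ^ 2) := by
    simp [pt, h0]; ring
  rw [e] at h1
  rw [← sq_eq_sq₀ (norm_nonneg _) (norm_nonneg _), ← h2]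
  linear_combination y ^ 2 * h - h1

lemma pt_neg_right (J : ℍ[ℝ]) (x y : ℝ) : pt J x (-y) = pt (-J) x y := by
  simp [pt]

lemma pt_zero_right (J : ℍ[ℝ]) (x : ℝ) : pt J x 0 = x := by simp [pt]

lemma pt_mem_ball {J : ℍ[ℝ]} (hJ : J ∈ imagUnits) {x y r : ℝ} :
    pt J x y ∈ Metric.ball (0 : ℍ[ℝ]) r ↔ (⟨x, y⟩ : ℂ) ∈ Metric.ball (0 : ℂ) r := by
  simp [norm_pt hJ]

lemma exists_pt (q : ℍ[ℝ]) : ∃ J ∈ imagUnits, q = pt J q.re ‖q.im‖ := by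
  by_cases h : q.im = 0
  · refine ⟨unitI, unitI_mem, ?_⟩
    rw [h, norm_zero, pt_zero_right]
    conv_lhs => rw [← Quaternion.re_add_im q, h, add_zero]
  · have hn : ‖q.im‖ ≠ 0 := norm_ne_zero_iff.2 h
    refine ⟨‖q.im‖⁻¹ • q.im, ⟨by simp, by rw [norm_smul]; simp [hn]⟩, ?_⟩
    conv_lhs => rw [← Quaternion.re_add_im q]
    rw [pt]
    congr 1
    rw [← Quaternion.coe_commutes, Quaternion.coe_mul_eq_smul, smul_smul, mul_inv_cancel₀ hn,
      one_smul]

/-! ### Slice functions, stem functions and the star product -/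

lemma alpha_neg (f : ℍ[ℝ] → ℍ[ℝ]) (x y : ℝ) : alpha f x (-y) = alpha f x y := by
  simp [alpha, add_comm]

lemma beta_neg (f : ℍ[ℝ] → ℍ[ℝ]) (x y : ℝ) : beta f x (-y) = -beta f x y := by
  rw [beta, beta, neg_neg, ← smul_neg, ← mul_neg, neg_sub]

lemma alpha_add_beta (f : ℍ[ℝ] → ℍ[ℝ]) (x y : ℝ) :
    alpha f x y + unitI * beta f x y = f (pt unitI x y) := by
  rw [alpha, beta, mul_smul_comm, ← mul_assoc, mul_self_of_mem_imagUnits unitI_mem, ← smul_add]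
  rw [show f (pt unitI x y) + f (pt unitI x (-y)) + -1 * (f (pt unitI x (-y)) - f (pt unitI x y))
    = (2 : ℝ) • f (pt unitI x y) by rw [two_smul]; noncomm_ring, smul_smul]
  norm_num

/-- Parity conditions that make `induced a b` a well-defined slice function. -/
structure EvenOdd (a b : ℝ → ℝ → ℍ[ℝ]) : Prop where
  even : ∀ x y, a x (-y) = a x y
  odd : ∀ x y, b x (-y) = -b x y

lemma EvenOdd.apply_zero {a b : ℝ → ℝ → ℍ[ℝ]} (h : EvenOdd a b) (x : ℝ) : b x 0 = 0 := by
  have := h.odd x 0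
  rw [neg_zero, eq_neg_iff_add_eq_zero, ← two_smul ℝ] at this
  exact (smul_eq_zero.1 this).resolve_left two_ne_zero

/-- `(J, x, y)` and `(-J, x, -y)` name the same point; the parities of `a` and `b` make the two
readings agree, and at `y = 0` oddness kills the term with `J`. -/
lemma induced_pt {a b : ℝ → ℝ → ℍ[ℝ]} (h : EvenOdd a b) {J : ℍ[ℝ]} (hJ : J ∈ imagUnits)
    (x y : ℝ) : induced a b (pt J x y) = a x y + J * b x y := by
  rw [induced, pt_re hJ, norm_pt_im hJ, pt_im hJ]
  rcases lt_trichotomy y 0 with hy | rfl | hy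
  · rw [abs_of_neg hy, h.even, h.odd, smul_smul, inv_neg, neg_mul, inv_mul_cancel₀ hy.ne]
    simp
  · simp [h.apply_zero]
  · rw [abs_of_pos hy, smul_smul, inv_mul_cancel₀ hy.ne']
    simp

lemma alpha_induced {a b : ℝ → ℝ → ℍ[ℝ]} (h : EvenOdd a b) (x y : ℝ) :
    alpha (induced a b) x y = a x y := by
  rw [alpha, induced_pt h unitI_mem, induced_pt h unitI_mem, h.even, h.odd]
  rw [show a x y + unitI * b x y + (a x y + unitI * -b x y) = (2 : ℝ) • a x y by
    rw [two_smul]; noncomm_ring, smul_smul]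
  norm_num

lemma beta_induced {a b : ℝ → ℝ → ℍ[ℝ]} (h : EvenOdd a b) (x y : ℝ) :
    beta (induced a b) x y = b x y := by
  rw [beta, induced_pt h unitI_mem, induced_pt h unitI_mem, h.even, h.odd]
  rw [show unitI * (a x y + unitI * -b x y - (a x y + unitI * b x y)) =
    (-(unitI * unitI)) * ((2 : ℝ) • b x y) by rw [two_smul]; noncomm_ring,
    mul_self_of_mem_imagUnits unitI_mem, neg_neg, one_mul, smul_smul]
  norm_num

lemma evenOdd_starMul (f g : ℍ[ℝ] → ℍ[ℝ]) :
    EvenOdd (fun x y => alpha f x y * alpha g x y - beta f x y * beta g x y)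
    (fun x y => alpha f x y * beta g x y + beta f x y * alpha g x y) := by
  constructor <;> intro x y <;> simp only [alpha_neg, beta_neg] <;> noncomm_ring

lemma evenOdd_conjFun (f : ℍ[ℝ] → ℍ[ℝ]) :
    EvenOdd (fun x y => star (alpha f x y)) (fun x y => star (beta f x y)) := by
  constructor <;> intro x y <;> simp only [alpha_neg, beta_neg, star_neg]

/-- The defining formula of `⋆` is multiplication in `ℍ[ℂ]`. Iterated star products thereby become
associative products of stem functions. -/
lemma stem_starMul (f g : ℍ[ℝ] → ℍ[ℝ]) (z : ℂ) :
    stem (starMul f g) z = stem f z * stem g z := by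
  rw [stem, starMul, alpha_induced (evenOdd_starMul f g), beta_induced (evenOdd_starMul f g),
    stem, stem, cx_mul]

lemma starMul_pt (f g : ℍ[ℝ] → ℍ[ℝ]) {J : ℍ[ℝ]} (hJ : J ∈ imagUnits) (z : ℂ) :
    starMul f g (pt J z.re z.im) = ev J (stem f z * stem g z) := by
  rw [starMul, induced_pt (evenOdd_starMul f g) hJ, stem, stem, cx_mul]
  rfl

lemma stem_conjFun (f : ℍ[ℝ] → ℍ[ℝ]) (z : ℂ) : stem (conjFun f) z = star (stem f z) := by
  rw [stem, conjFun, alpha_induced (evenOdd_conjFun f), beta_induced (evenOdd_conjFun f), stem]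
  ext <;> apply Complex.ext <;> simp

lemma ev_coe (J : ℍ[ℝ]) (w : ℂ) : ev J (w : ℍ[ℂ]) = pt J w.re w.im := by
  have h1 : rePart (w : ℍ[ℂ]) = (w.re : ℍ[ℝ]) := by ext <;> simp
  have h2 : imPart (w : ℍ[ℂ]) = (w.im : ℍ[ℝ]) := by ext <;> simp
  rw [ev, h1, h2, pt]

/-- `f^c` has stem function `star F`, and `F * star F` is the scalar `normSq F`. So `f^s` acts on
every slice as the same complex function, and its modulus does not depend on `J`. -/
lemma symm_pt (f : ℍ[ℝ] → ℍ[ℝ]) {J : ℍ[ℝ]} (hJ : J ∈ imagUnits) (z : ℂ) :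
    symm f (pt J z.re z.im) = pt J (stemNorm f z).re (stemNorm f z).im := by
  rw [symm, starMul_pt _ _ hJ, stem_conjFun, Quaternion.self_mul_star, ev_coe]
  rfl

lemma norm_symm_pt (f : ℍ[ℝ] → ℍ[ℝ]) {J : ℍ[ℝ]} (hJ : J ∈ imagUnits) (z : ℂ) :
    ‖symm f (pt J z.re z.im)‖ = ‖stemNorm f z‖ := by
  rw [symm_pt f hJ, norm_pt hJ]

lemma stem_conj (f : ℍ[ℝ] → ℍ[ℝ]) (z : ℂ) : stem f (starRingEnd ℂ z) = cconj (stem f z) := by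
  rw [stem, stem, cconj_cx, Complex.conj_re, Complex.conj_im, alpha_neg, beta_neg]

lemma stemNorm_conj (f : ℍ[ℝ] → ℍ[ℝ]) (z : ℂ) :
    stemNorm f (starRingEnd ℂ z) = starRingEnd ℂ (stemNorm f z) := by
  rw [stemNorm, stemNorm, stem_conj, Quaternion.normSq_def', Quaternion.normSq_def']
  simp only [map_add, map_pow]
  congr 1

lemma ev_unitI_stem (f : ℍ[ℝ] → ℍ[ℝ]) (z : ℂ) :
    ev unitI (stem f z) = f (pt unitI z.re z.im) := alpha_add_beta f z.re z.im

/-- The stem function only depends on the values at two conjugate points of the `i`-slice. -/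
lemma stem_eq_of_ev {f : ℍ[ℝ] → ℍ[ℝ]} {z : ℂ} {w : ℍ[ℂ]}
    (h1 : f (pt unitI z.re z.im) = ev unitI w)
    (h2 : f (pt unitI z.re (-z.im)) = ev unitI (cconj w)) : stem f z = w := by
  have e1 : alpha f z.re z.im = rePart w := by
    rw [alpha, h1, h2, ev, ev, cconj, rePart_cx, imPart_cx,
      show rePart w + unitI * imPart w + (rePart w + unitI * -imPart w) = (2 : ℝ) • rePart w by
        rw [two_smul]; noncomm_ring, smul_smul]
    norm_num
  have e2 : beta f z.re z.im = imPart w := by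
    rw [beta, h1, h2, ev, ev, cconj, rePart_cx, imPart_cx,
      show unitI * (rePart w + unitI * -imPart w - (rePart w + unitI * imPart w))
        = (-(unitI * unitI)) * ((2 : ℝ) • imPart w) by rw [two_smul]; noncomm_ring,
        mul_self_of_mem_imagUnits unitI_mem, neg_neg, one_mul, smul_smul]
    norm_num
  rw [stem, e1, e2, cx_rePart_imPart]

/-- Evaluation at `J` is not multiplicative in general, but it is linear over the central scalars
`ℂ`, with `i` acting as left multiplication by `J`. -/
lemma ev_mul_coe (J : ℍ[ℝ]) (hJ : J ∈ imagUnits) (c : ℂ) (w : ℍ[ℂ]) :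
    ev J ((c : ℍ[ℂ]) * w) = pt J c.re c.im * ev J w := by
  have hs := mul_self_of_mem_imagUnits hJ
  have e : (c : ℍ[ℂ]) * w = cx ((c.re : ℍ[ℝ]) * rePart w - (c.im : ℍ[ℝ]) * imPart w)
      ((c.re : ℍ[ℝ]) * imPart w + (c.im : ℍ[ℝ]) * rePart w) := by
    ext <;> apply Complex.ext <;> simp
  rw [e, ev, ev, rePart_cx, imPart_cx, pt]
  have h1 : J * (c.re : ℍ[ℝ]) = (c.re : ℍ[ℝ]) * J := (Quaternion.coe_commutes _ _).symm
  have h2 : J * (c.im : ℍ[ℝ]) * J = -(c.im : ℍ[ℝ]) := by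
    rw [mul_assoc, Quaternion.coe_commutes, ← mul_assoc, hs]; simp
  calc _ = (c.re : ℍ[ℝ]) * rePart w - (c.im : ℍ[ℝ]) * imPart w
      + ((J * (c.re : ℍ[ℝ])) * imPart w + J * (c.im : ℍ[ℝ]) * rePart w) := by noncomm_ring
    _ = (c.re : ℍ[ℝ]) * rePart w + (J * (c.im : ℍ[ℝ]) * J) * imPart w
      + (((c.re : ℍ[ℝ]) * J) * imPart w + J * (c.im : ℍ[ℝ]) * rePart w) := by
        rw [h1, h2]; noncomm_ring
    _ = _ := by noncomm_ring

/-- If `P` takes the values `p` on the `i`-slice, with `p` a real function, then pointwise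
multiplication by `P` corresponds to multiplication of the stem function by `p`. -/
lemma stem_mul_of_slice {P g : ℍ[ℝ] → ℍ[ℝ]} {z p : ℂ}
    (h1 : P (pt unitI z.re z.im) = pt unitI p.re p.im)
    (h2 : P (pt unitI z.re (-z.im)) = pt unitI p.re (-p.im)) :
    stem (fun q => P q * g q) z = (p : ℍ[ℂ]) * stem g z := by
  apply stem_eq_of_ev
  · rw [ev_mul_coe _ unitI_mem, ev_unitI_stem, h1]
  · have : cconj (p : ℍ[ℂ]) = ((starRingEnd ℂ p : ℂ) : ℍ[ℂ]) := by
      ext <;> apply Complex.ext <;> simp [cconj]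
    rw [cconj_mul, this, ev_mul_coe _ unitI_mem, ← stem_conj, ev_unitI_stem, h2]
    simp

lemma stem_congr {f g : ℍ[ℝ] → ℍ[ℝ]} {z : ℂ} (h1 : f (pt unitI z.re z.im) = g (pt unitI z.re z.im))
    (h2 : f (pt unitI z.re (-z.im)) = g (pt unitI z.re (-z.im))) : stem f z = stem g z := by
  rw [stem, stem, alpha, alpha, beta, beta, h1, h2]

/-! ### Stem functions of polynomial factors -/

lemma pt_add_pt (J : ℍ[ℝ]) (z w : ℂ) :
    pt J z.re z.im + pt J w.re w.im = pt J (z + w).re (z + w).im := by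
  simp only [pt, Complex.add_re, Complex.add_im, Quaternion.coe_add]; noncomm_ring

lemma pt_mul_pt {J : ℍ[ℝ]} (hJ : J ∈ imagUnits) (z w : ℂ) :
    pt J z.re z.im * pt J w.re w.im = pt J (z * w).re (z * w).im := by
  rw [← ev_coe J w, ← ev_mul_coe J hJ, ← Quaternion.coe_mul, ev_coe]

lemma pt_pow {J : ℍ[ℝ]} (hJ : J ∈ imagUnits) (z : ℂ) (n : ℕ) :
    pt J z.re z.im ^ n = pt J (z ^ n).re (z ^ n).im := by
  induction n with
  | zero => simp [pt]
  | succ n ih => rw [pow_succ, ih, pt_mul_pt hJ, pow_succ]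

lemma sphFactor_pt {J : ℍ[ℝ]} (hJ : J ∈ imagUnits) (x y : ℝ) (z : ℂ) :
    sphFactor x y (pt J z.re z.im) =
      pt J ((z - x) ^ 2 + (y : ℂ) ^ 2).re ((z - x) ^ 2 + (y : ℂ) ^ 2).im := by
  have h1 : pt J z.re z.im - (x : ℍ[ℝ]) = pt J (z - x).re (z - x).im := by
    simp [pt]; abel
  have h2 : ((y ^ 2 : ℝ) : ℍ[ℝ]) = pt J ((y : ℂ) ^ 2).re ((y : ℂ) ^ 2).im := by
    rw [← Complex.ofReal_pow, Complex.ofReal_re, Complex.ofReal_im, pt_zero_right]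
  rw [sphFactor, h1, pt_pow hJ, h2, pt_add_pt]

lemma stem_sphFactor_pow_mul (x y : ℝ) (m : ℕ) (g : ℍ[ℝ] → ℍ[ℝ]) (z : ℂ) :
    stem (fun q => sphFactor x y q ^ m * g q) z =
      ((((z - x) ^ 2 + (y : ℂ) ^ 2) ^ m : ℂ) : ℍ[ℂ]) * stem g z := by
  apply stem_mul_of_slice (P := fun q => sphFactor x y q ^ m)
  · rw [sphFactor_pt unitI_mem, pt_pow unitI_mem]
  · have := sphFactor_pt unitI_mem x y (starRingEnd ℂ z)
    rw [Complex.conj_re, Complex.conj_im] at this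
    rw [this, pt_pow unitI_mem]
    have e : ((starRingEnd ℂ z - x) ^ 2 + (y : ℂ) ^ 2) ^ m =
      starRingEnd ℂ (((z - x) ^ 2 + (y : ℂ) ^ 2) ^ m) := by simp
    rw [e, Complex.conj_re, Complex.conj_im]

lemma stem_sub_real_pow_mul (a : ℝ) (m : ℕ) (g : ℍ[ℝ] → ℍ[ℝ]) (z : ℂ) :
    stem (fun q => (q - (a : ℍ[ℝ])) ^ m * g q) z = (((z - a) ^ m : ℂ) : ℍ[ℂ]) * stem g z := by
  have h1 : ∀ z : ℂ, pt unitI z.re z.im - (a : ℍ[ℝ]) = pt unitI (z - a).re (z - a).im := by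
    intro z; simp [pt]; abel
  apply stem_mul_of_slice (P := fun q => (q - (a : ℍ[ℝ])) ^ m)
  · rw [h1, pt_pow unitI_mem]
  · have := h1 (starRingEnd ℂ z)
    rw [Complex.conj_re, Complex.conj_im] at this
    rw [this, pt_pow unitI_mem]
    have e : (starRingEnd ℂ z - a) ^ m = starRingEnd ℂ ((z - a) ^ m) := by simp
    rw [e, Complex.conj_re, Complex.conj_im]

/-- The stem function of `q ↦ q - a`. -/
def lin (a : ℍ[ℝ]) (z : ℂ) : ℍ[ℂ] := cx ((z.re : ℍ[ℝ]) - a) (z.im : ℍ[ℝ])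

lemma stem_sub (a : ℍ[ℝ]) (z : ℂ) : stem (fun q => q - a) z = lin a z := by
  apply stem_eq_of_ev
  · rw [ev, lin, rePart_cx, imPart_cx, pt]; abel
  · rw [ev, lin, cconj_cx, rePart_cx, imPart_cx, pt, Quaternion.coe_neg]; abel

lemma stem_starFactors_cons (a : ℍ[ℝ]) (L : List ℍ[ℝ]) (g : ℍ[ℝ] → ℍ[ℝ]) (z : ℂ) :
    stem (starFactors (a :: L) g) z = lin a z * stem (starFactors L g) z := by
  rw [starFactors, List.foldr_cons, stem_starMul, stem_sub]; rfl

lemma starFactors_cons_pt (a : ℍ[ℝ]) (L : List ℍ[ℝ]) (g : ℍ[ℝ] → ℍ[ℝ]) {J : ℍ[ℝ]}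
    (hJ : J ∈ imagUnits) (z : ℂ) :
    starFactors (a :: L) g (pt J z.re z.im) = ev J (stem (starFactors (a :: L) g) z) := by
  rw [stem_starFactors_cons, starFactors, List.foldr_cons, starMul_pt _ _ hJ, stem_sub]; rfl

/-- The product of the stem functions of the factors `q - a`. -/
def linProd (L : List ℍ[ℝ]) (z : ℂ) : ℍ[ℂ] := (L.map fun a => lin a z).prod

lemma stem_starFactors (L : List ℍ[ℝ]) (g : ℍ[ℝ] → ℍ[ℝ]) (z : ℂ) :
    stem (starFactors L g) z = linProd L z * stem g z := by
  induction L with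
  | nil => simp [starFactors, linProd]
  | cons a L ih => rw [stem_starFactors_cons, ih, linProd, linProd, List.map_cons,
      List.prod_cons, mul_assoc]

lemma normSq_lin {K : ℍ[ℝ]} (hK : K ∈ imagUnits) (x y : ℝ) (z : ℂ) :
    Quaternion.normSq (lin (pt K x y) z) = (z - x) ^ 2 + (y : ℂ) ^ 2 := by
  have h := sq_of_mem_imagUnits hK
  have h0 := hK.1
  rw [Quaternion.normSq_def']
  apply Complex.ext
  · simp [lin, pt, h0, pow_two]
    linear_combination y ^ 2 * h
  · simp [lin, pt, h0, pow_two]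


lemma lin_star_mul_lin {K : ℍ[ℝ]} (hK : K ∈ imagUnits) (x y : ℝ) (z : ℂ) :
    lin (pt (-K) x y) z * lin (pt K x y) z = (((z - x) ^ 2 + (y : ℂ) ^ 2 : ℂ) : ℍ[ℂ]) := by
  rw [← normSq_lin hK x y z, ← Quaternion.star_mul_self]
  congr 1
  have h0 := hK.1
  ext <;> apply Complex.ext <;> simp [lin, pt, h0]

lemma star_pt {K : ℍ[ℝ]} (hK : K ∈ imagUnits) (x y : ℝ) : star (pt K x y) = pt (-K) x y := by
  rw [pt, pt, star_add, star_mul, Quaternion.star_coe, Quaternion.star_coe,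
    star_of_mem_imagUnits hK, Quaternion.coe_commutes]

lemma lin_mul_lin_star {K : ℍ[ℝ]} (hK : K ∈ imagUnits) (x y : ℝ) (z : ℂ) :
    lin (pt K x y) z * lin (pt (-K) x y) z = (((z - x) ^ 2 + (y : ℂ) ^ 2 : ℂ) : ℍ[ℂ]) := by
  have := lin_star_mul_lin (neg_mem_imagUnits hK) x y z
  rwa [neg_neg] at this

/-- On its own sphere, star multiplication by `q - a` is evaluation at the conjugate of `a`
followed by multiplication by `q - a`. -/
lemma ev_lin_mul {J K : ℍ[ℝ]} (hJ : J ∈ imagUnits) (hK : K ∈ imagUnits) (x y : ℝ) (w : ℍ[ℂ]) :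
    ev J (lin (pt K x y) ⟨x, y⟩ * w) = (pt J x y - pt K x y) * ev (-K) w := by
  have hs := mul_self_of_mem_imagUnits hJ
  have hk := mul_self_of_mem_imagUnits hK
  have hc : ∀ q : ℍ[ℝ], q * (y : ℍ[ℝ]) = (y : ℍ[ℝ]) * q :=
    fun q => (Quaternion.coe_commutes _ _).symm
  have e : lin (pt K x y) ⟨x, y⟩ * w = cx ((y : ℍ[ℝ]) * (-(K * rePart w) - imPart w))
      ((y : ℍ[ℝ]) * (rePart w - K * imPart w)) := by
    conv_lhs => rw [← cx_rePart_imPart w]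
    rw [lin, cx_mul, pt, hc]
    congr 1 <;> simp only <;> noncomm_ring
  rw [e, ev, ev, rePart_cx, imPart_cx, pt, pt, hc, hc, ← mul_assoc J, hc, mul_assoc]
  have : (x : ℍ[ℝ]) + (y : ℍ[ℝ]) * J - ((x : ℍ[ℝ]) + (y : ℍ[ℝ]) * K) = (y : ℍ[ℝ]) * (J - K) := by
    noncomm_ring
  rw [this, mul_assoc, ← mul_add]
  congr 1
  have : (J - K) * (rePart w + -K * imPart w)
    = J * rePart w - K * rePart w - J * K * imPart w + (K * K) * imPart w := by noncomm_ring
  rw [this, hk]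
  noncomm_ring

/-! ### Holomorphy of the stem function and the representation formula -/

open Filter Topology Metric

/-- The four coefficients of a quaternion. -/
def cf {R : Type*} [CommRing R] (k : Fin 4) (q : ℍ[R]) : R := ![q.re, q.imI, q.imJ, q.imK] k

/-- The standard basis of the quaternions. -/
def eb (k : Fin 4) : ℍ[ℝ] :=
  ⟨if k = 0 then 1 else 0, if k = 1 then 1 else 0, if k = 2 then 1 else 0, if k = 3 then 1 else 0⟩

@[simp] lemma eb_re (k : Fin 4) : (eb k).re = if k = 0 then 1 else 0 := rfl
@[simp] lemma eb_imI (k : Fin 4) : (eb k).imI = if k = 1 then 1 else 0 := rfl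
@[simp] lemma eb_imJ (k : Fin 4) : (eb k).imJ = if k = 2 then 1 else 0 := rfl
@[simp] lemma eb_imK (k : Fin 4) : (eb k).imK = if k = 3 then 1 else 0 := rfl

lemma cf_ext {R : Type*} [CommRing R] {a b : ℍ[R]} (h : ∀ k, cf k a = cf k b) : a = b := by
  exact QuaternionAlgebra.ext (h 0) (h 1) (h 2) (h 3)

/-- The coefficients as continuous linear forms. -/
def cfL (k : Fin 4) : ℍ[ℝ] →L[ℝ] ℝ := LinearMap.toContinuousLinearMap
  { toFun := cf k
    map_add' := fun a b => by fin_cases k <;> simp [cf]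
    map_smul' := fun a b => by fin_cases k <;> simp [cf] }

@[simp] lemma cfL_apply (k : Fin 4) (q : ℍ[ℝ]) : cfL k q = cf k q := rfl

lemma cf_cx (k : Fin 4) (a b : ℍ[ℝ]) : cf k (cx a b) = ⟨cf k a, cf k b⟩ := by
  fin_cases k <;> rfl

lemma cf_coe_mul {R : Type*} [CommRing R] (k : Fin 4) (c : R) (w : ℍ[R]) :
    cf k ((c : ℍ[R]) * w) = c * cf k w := by
  fin_cases k <;> simp [cf]

lemma cf_rePart (k : Fin 4) (w : ℍ[ℂ]) : cf k (rePart w) = (cf k w).re := by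
  fin_cases k <;> rfl

lemma cf_imPart (k : Fin 4) (w : ℍ[ℂ]) : cf k (imPart w) = (cf k w).im := by
  fin_cases k <;> rfl

lemma cf_cconj (k : Fin 4) (w : ℍ[ℂ]) : cf k (cconj w) = starRingEnd ℂ (cf k w) := by
  rw [cconj, cf_cx, ← cfL_apply k (-_), map_neg, cfL_apply, cf_rePart, cf_imPart]
  rfl

lemma sum_cf_smul_eb (q : ℍ[ℝ]) : ∑ k, cf k q • eb k = q := by
  rw [Fin.sum_univ_four]
  ext <;> simp [cf]

lemma coe_eq_smul_one (x : ℝ) : (x : ℍ[ℝ]) = x • 1 := by ext <;> simp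

/-- The inclusion of the slice `ℂ_J` as a continuous real linear map. -/
def slice (J : ℍ[ℝ]) : ℂ →L[ℝ] ℍ[ℝ] :=
  Complex.reCLM.smulRight 1 + Complex.imCLM.smulRight J

lemma slice_apply (J : ℍ[ℝ]) (z : ℂ) : slice J z = pt J z.re z.im := by
  rw [pt, ← Quaternion.coe_commutes, Quaternion.coe_mul_eq_smul]
  simp [slice, coe_eq_smul_one]

lemma slice_one (J : ℍ[ℝ]) : slice J 1 = 1 := by simp [slice]

lemma slice_I (J : ℍ[ℝ]) : slice J Complex.I = J := by simp [slice]

lemma SliceRegularOn.fderiv_apply {f : ℍ[ℝ] → ℍ[ℝ]} {U : Set ℍ[ℝ]} (hf : SliceRegularOn f U)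
    {J : ℍ[ℝ]} (hJ : J ∈ imagUnits) {z : ℂ} (hz : slice J z ∈ U) :
    fderiv ℝ f (slice J z) J = J * fderiv ℝ f (slice J z) 1 := by
  rw [slice_apply] at hz ⊢
  have h := hf.2 J hJ z.re z.im hz
  have h1 := (smul_eq_zero.1 h).resolve_left (by norm_num)
  have h2 := congrArg (fun q => J * q) h1
  simp only [mul_add, mul_zero, ← mul_assoc, mul_self_of_mem_imagUnits hJ] at h2
  rw [neg_one_mul, ← sub_eq_add_neg, sub_eq_zero] at h2
  exact h2.symm

/-- Slice regularity says that the real derivative along `ℂ_J` carries multiplication by `i` to left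
multiplication by `J`. A form `T` turning the latter back into `i` yields the Cauchy–Riemann
equations. -/
lemma SliceRegularOn.differentiableAt_comp {f : ℍ[ℝ] → ℍ[ℝ]} {U : Set ℍ[ℝ]}
    (hf : SliceRegularOn f U) (hU : IsOpen U) {J : ℍ[ℝ]} (hJ : J ∈ imagUnits)
    (T : ℍ[ℝ] →L[ℝ] ℂ) (hT : ∀ q, T (J * q) = Complex.I * T q) {z : ℂ} (hz : slice J z ∈ U) :
    DifferentiableAt ℂ (fun z => T (f (slice J z))) z := by
  have h1 : HasFDerivAt f (fderiv ℝ f (slice J z)) (slice J z) :=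
    ((hf.1 _ hz).differentiableAt (hU.mem_nhds hz)).hasFDerivAt
  have h2 := T.hasFDerivAt.comp z (h1.comp z (slice J).hasFDerivAt)
  refine (h2.complexOfReal_hasFDerivAt ?_).differentiableAt
  simp only [ContinuousLinearMap.comp_apply, slice_I, slice_one, hf.fderiv_apply hJ hz, hT,
    smul_eq_mul]

/-- The complex linear form on `(ℍ, J)` with real part half the `k`-th coefficient. -/
def cform (J : ℍ[ℝ]) (k : Fin 4) : ℍ[ℝ] →L[ℝ] ℂ :=
  (1 / 2 : ℂ) • (Complex.ofRealCLM ∘L cfL k -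
    Complex.I • (Complex.ofRealCLM ∘L cfL k ∘L ContinuousLinearMap.mul ℝ ℍ[ℝ] J))

lemma cform_apply (J : ℍ[ℝ]) (k : Fin 4) (q : ℍ[ℝ]) :
    cform J k q = (1 / 2 : ℂ) * (((cf k q : ℝ) : ℂ) - Complex.I * ((cf k (J * q) : ℝ) : ℂ)) := rfl

lemma cform_mul {J : ℍ[ℝ]} (hJ : J ∈ imagUnits) (k : Fin 4) (q : ℍ[ℝ]) :
    cform J k (J * q) = Complex.I * cform J k q := by
  rw [cform_apply, cform_apply, ← mul_assoc J, mul_self_of_mem_imagUnits hJ, neg_one_mul,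
    ← cfL_apply k (-q), map_neg, cfL_apply, Complex.ofReal_neg]
  linear_combination (1 / 2 * ((cf k (J * q) : ℝ) : ℂ)) * Complex.I_mul_I

lemma eq_of_cform_eq {J : ℍ[ℝ]} {p q : ℍ[ℝ]} (h : ∀ k, cform J k p = cform J k q) : p = q := by
  apply cf_ext
  intro k
  have := congrArg Complex.re (h k)
  simp [cform_apply] at this
  linarith

/-- With `F = cform unitI k ∘ f ∘ slice unitI`, which is holomorphic for slice regular `f`, this is
`F (z) + conj (F (conj z))`; holomorphy of the stem function is then visible. -/
lemma cf_stem (f : ℍ[ℝ] → ℍ[ℝ]) (k : Fin 4) (z : ℂ) :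
    cf k (stem f z) = cform unitI k (f (slice unitI z)) +
      starRingEnd ℂ (cform unitI k (f (slice unitI (starRingEnd ℂ z)))) := by
  rw [stem, cf_cx, slice_apply, slice_apply, cform_apply, cform_apply, alpha, beta,
    ← cfL_apply, ← cfL_apply k (_ • _), map_smul, map_smul, mul_sub, map_sub, map_add]
  simp only [cfL_apply]
  apply Complex.ext <;> simp <;> ring

lemma slice_mem_ball {J : ℍ[ℝ]} (hJ : J ∈ imagUnits) {z : ℂ} {r : ℝ} :
    slice J z ∈ ball (0 : ℍ[ℝ]) r ↔ z ∈ ball (0 : ℂ) r := by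
  rw [slice_apply, pt_mem_ball hJ]

lemma norm_slice {J : ℍ[ℝ]} (hJ : J ∈ imagUnits) (z : ℂ) : ‖slice J z‖ = ‖z‖ := by
  rw [slice_apply, norm_pt hJ]

lemma conj_mem_ball {z : ℂ} {r : ℝ} (hz : z ∈ ball (0 : ℂ) r) :
    starRingEnd ℂ z ∈ ball (0 : ℂ) r := by
  simpa using hz

/-- Holomorphic stem functions on the disc of radius `r`. -/
structure HolStem (r : ℝ) (Φ : ℂ → ℍ[ℂ]) : Prop where
  diff : ∀ k, DifferentiableOn ℂ (fun z => cf k (Φ z)) (ball 0 r)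
  symm : ∀ z, Φ (starRingEnd ℂ z) = cconj (Φ z)

lemma SliceRegularOn.holStem {f : ℍ[ℝ] → ℍ[ℝ]} {r : ℝ} (hf : SliceRegularOn f (ball 0 r)) :
    HolStem r (stem f) := by
  refine ⟨fun k z hz => DifferentiableAt.differentiableWithinAt ?_, stem_conj f⟩
  simp only [cf_stem]
  have h1 : ∀ z ∈ ball (0 : ℂ) r,
      DifferentiableAt ℂ (fun z => cform unitI k (f (slice unitI z))) z := fun z hz =>
    hf.differentiableAt_comp isOpen_ball unitI_mem _ (cform_mul unitI_mem k)
      ((slice_mem_ball unitI_mem).2 hz)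
  refine (h1 z hz).add ?_
  have h2 := (h1 _ (conj_mem_ball hz)).conj_conj
  rwa [Complex.conj_conj] at h2

lemma map_ev {J : ℍ[ℝ]} (T : ℍ[ℝ] →L[ℝ] ℂ) (hT : ∀ q, T (J * q) = Complex.I * T q) (w : ℍ[ℂ]) :
    T (ev J w) = ∑ k, cf k w * T (eb k) := by
  rw [ev, map_add, hT]
  conv_lhs => rw [← sum_cf_smul_eb (rePart w), ← sum_cf_smul_eb (imPart w)]
  rw [map_sum, map_sum, Finset.mul_sum, ← Finset.sum_add_distrib]
  refine Finset.sum_congr rfl fun k _ => ?_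
  rw [map_smul, map_smul, cf_rePart, cf_imPart, Complex.real_smul, Complex.real_smul]
  conv_rhs => rw [← Complex.re_add_im (cf k w)]
  ring

/-- The representation formula. -/
lemma SliceRegularOn.eq_ev_stem {f : ℍ[ℝ] → ℍ[ℝ]} {r : ℝ} (hf : SliceRegularOn f (ball 0 r))
    {J : ℍ[ℝ]} (hJ : J ∈ imagUnits) {z : ℂ} (hz : z ∈ ball (0 : ℂ) r) :
    f (slice J z) = ev J (stem f z) := by
  have hr : 0 < r := pos_of_mem_ball hz
  apply eq_of_cform_eq (J := J)
  intro k
  have h1 : AnalyticOnNhd ℂ (fun z => cform J k (f (slice J z))) (ball 0 r) :=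
    DifferentiableOn.analyticOnNhd (fun z hz => (hf.differentiableAt_comp isOpen_ball hJ _
      (cform_mul hJ k) ((slice_mem_ball hJ).2 hz)).differentiableWithinAt) isOpen_ball
  have h2 : AnalyticOnNhd ℂ (fun z => cform J k (ev J (stem f z))) (ball 0 r) := by
    refine DifferentiableOn.analyticOnNhd ?_ isOpen_ball
    simp only [map_ev _ (cform_mul hJ k)]
    exact DifferentiableOn.fun_sum fun i _ => (hf.holStem.diff i).mul_const _
  -- Identity theorem: at real points `β` vanishes, so both sides equal `f x` whatever `J` is, and
  -- the reals `1 / (n + 1)` accumulate at `0`.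
  refine h1.eqOn_of_preconnected_of_frequently_eq h2 (convex_ball 0 r).isPreconnected
    (mem_ball_self hr) ?_ hz
  have ht : Tendsto (fun n : ℕ => (((1 : ℝ) / ((n : ℝ) + 1) : ℝ) : ℂ)) atTop (𝓝[≠] 0) := by
    refine tendsto_nhdsWithin_iff.2 ⟨?_, Eventually.of_forall fun n => ?_⟩
    · have := (Complex.continuous_ofReal.tendsto 0).comp
        (tendsto_one_div_add_atTop_nhds_zero_nat (𝕜 := ℝ))
      rwa [Complex.ofReal_zero] at this
    · simp only [Set.mem_compl_iff, Set.mem_singleton_iff, Complex.ofReal_eq_zero]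
      positivity
  refine ht.frequently (Eventually.of_forall fun n => ?_).frequently
  congr 1
  generalize (1 : ℝ) / ((n : ℝ) + 1) = x
  have e := ev_unitI_stem f x
  rw [slice_apply, Complex.ofReal_re, Complex.ofReal_im, pt_zero_right]
  rw [Complex.ofReal_re, Complex.ofReal_im, pt_zero_right] at e
  rw [← e, ev, ev, stem, imPart_cx, Complex.ofReal_im]
  have := beta_neg f (x : ℂ).re 0
  rw [neg_zero, eq_neg_iff_add_eq_zero, ← two_smul ℝ] at this
  rw [(smul_eq_zero.1 this).resolve_left two_ne_zero, mul_zero, mul_zero]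

/-! ### From holomorphic stem functions to slice regular functions -/

/-- The slice parameter `x + i |y|` of a quaternion. -/
def param (q : ℍ[ℝ]) : ℂ := ⟨q.re, ‖q.im‖⟩

/-- The intrinsic function with values `φ` on the slices. -/
def intr (φ : ℂ → ℂ) (q : ℍ[ℝ]) : ℍ[ℝ] :=
  ((φ (param q)).re : ℍ[ℝ]) + (‖q.im‖⁻¹ • q.im) * ((φ (param q)).im : ℍ[ℝ])

lemma intr_slice {φ : ℂ → ℂ} (hφ : ∀ z, φ (starRingEnd ℂ z) = starRingEnd ℂ (φ z)) {J : ℍ[ℝ]}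
    (hJ : J ∈ imagUnits) (z : ℂ) : intr φ (slice J z) = slice J (φ z) := by
  have h : EvenOdd (fun x y => ((φ ⟨x, y⟩).re : ℍ[ℝ])) (fun x y => ((φ ⟨x, y⟩).im : ℍ[ℝ])) := by
    constructor <;> intro x y <;> have := hφ ⟨x, y⟩ <;>
      rw [show starRingEnd ℂ (⟨x, y⟩ : ℂ) = ⟨x, -y⟩ from rfl] at this <;> simp [this]
  rw [slice_apply, slice_apply]
  exact induced_pt h hJ z.re z.im

lemma exists_slice (q : ℍ[ℝ]) : ∃ J ∈ imagUnits, q = slice J (param q) := by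
  obtain ⟨J, hJ, h⟩ := exists_pt q
  exact ⟨J, hJ, by rw [slice_apply]; exact h⟩

lemma norm_param (q : ℍ[ℝ]) : ‖param q‖ = ‖q‖ := by
  obtain ⟨J, hJ, h⟩ := exists_slice q
  conv_rhs => rw [h, norm_slice hJ]

lemma differentiableAt_im (q : ℍ[ℝ]) : DifferentiableAt ℝ (fun q : ℍ[ℝ] => q.im) q := by
  have : (fun q : ℍ[ℝ] => q.im) = fun q => q - cfL 0 q • (1 : ℍ[ℝ]) := by
    ext q <;> simp [cf]
  rw [this]
  fun_prop

lemma differentiableAt_param {q : ℍ[ℝ]} (hq : q.im ≠ 0) : DifferentiableAt ℝ param q := by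
  have h1 : DifferentiableAt ℝ (fun q : ℍ[ℝ] => q.re) q := (cfL 0).differentiableAt
  have h2 := (differentiableAt_im q).norm ℝ hq
  have : param = fun q : ℍ[ℝ] => Complex.ofRealCLM q.re + ‖q.im‖ • Complex.I := by
    ext q
    apply Complex.ext <;> simp [param]
  rw [this]
  exact (Complex.ofRealCLM.differentiableAt.comp q h1).add (h2.smul_const _)

/-- The chain rule fails here because `|Im q|` is not differentiable on the real axis. Conjugation
symmetry makes `φ' (x)` a real number `c`, and since each slice is embedded isometrically, the error
of the approximation by `c • id` has the same norm as the error for `φ`. -/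
lemma differentiableAt_intr_of_real {φ : ℂ → ℂ}
    (hφ : ∀ z, φ (starRingEnd ℂ z) = starRingEnd ℂ (φ z)) {x : ℝ} (hd : DifferentiableAt ℂ φ x) :
    DifferentiableAt ℝ (intr φ) (x : ℍ[ℝ]) := by
  obtain ⟨c, hc⟩ : ∃ c : ℝ, deriv φ x = c := by
    have h1 := hd.hasDerivAt.conj_conj
    have h2 : (starRingEnd ℂ ∘ φ ∘ starRingEnd ℂ) = φ := by
      ext z; simp [hφ]
    rw [h2, Complex.conj_ofReal] at h1
    exact ⟨_, (Complex.conj_eq_iff_real.1 (h1.unique hd.hasDerivAt)).choose_spec⟩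
  have hder := hd.hasDerivAt
  rw [hc] at hder
  obtain ⟨b, hb⟩ : ∃ b : ℝ, φ x = b := by
    have := hφ x
    rw [Complex.conj_ofReal] at this
    exact Complex.conj_eq_iff_real.1 this.symm
  have e0 : intr φ x = (b : ℍ[ℝ]) := by
    have := intr_slice hφ unitI_mem x
    rw [hb, slice_apply, slice_apply] at this
    simpa [pt_zero_right] using this
  refine (HasFDerivAt.of_isLittleO (f' := c • ContinuousLinearMap.id ℝ ℍ[ℝ]) ?_).differentiableAt
  have hn : ∀ q : ℍ[ℝ], ‖param q - x‖ = ‖q - (x : ℍ[ℝ])‖ := by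
    intro q
    obtain ⟨J, hJ, h⟩ := exists_slice q
    have : q - (x : ℍ[ℝ]) = slice J (param q - x) := by
      rw [map_sub, ← h, slice_apply J (x : ℂ)]; simp [pt_zero_right]
    rw [this, norm_slice hJ]
  have hn' : ∀ q : ℍ[ℝ], ‖φ (param q) - φ x - (param q - x) • (c : ℂ)‖ =
      ‖intr φ q - intr φ x - (c • ContinuousLinearMap.id ℝ ℍ[ℝ]) (q - (x : ℍ[ℝ]))‖ := by
    intro q
    obtain ⟨J, hJ, h⟩ := exists_slice q
    have h1 : q - (x : ℍ[ℝ]) = slice J (param q - x) := by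
      rw [map_sub, ← h, slice_apply J (x : ℂ)]; simp [pt_zero_right]
    have h2 : intr φ q = slice J (φ (param q)) := by
      conv_lhs => rw [h, intr_slice hφ hJ]
    have h3 : (b : ℍ[ℝ]) = slice J (φ x) := by
      rw [hb, slice_apply]; simp [pt_zero_right]
    rw [h1, h2, e0, h3, smul_apply, ContinuousLinearMap.id_apply,
      ← map_smul, ← map_sub, ← map_sub, norm_slice hJ, smul_eq_mul, Complex.real_smul,
      mul_comm (c : ℂ)]
  have hlim : Tendsto param (𝓝 (x : ℍ[ℝ])) (𝓝 (x : ℂ)) := by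
    rw [tendsto_iff_norm_sub_tendsto_zero]
    simp only [hn]
    rw [← tendsto_iff_norm_sub_tendsto_zero]
    exact tendsto_id
  have ho := (hasDerivAt_iff_isLittleO.1 hder).comp_tendsto hlim
  exact (Asymptotics.isLittleO_norm_left.1 (Asymptotics.isLittleO_norm_right.1
    (by simpa only [Function.comp_def, hn, hn'] using ho.norm_norm)))

lemma differentiableAt_intr {φ : ℂ → ℂ}
    (hφ : ∀ z, φ (starRingEnd ℂ z) = starRingEnd ℂ (φ z)) {q : ℍ[ℝ]}
    (hd : DifferentiableAt ℂ φ (param q)) : DifferentiableAt ℝ (intr φ) q := by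
  by_cases hq : q.im = 0
  · have h1 : q = (q.re : ℍ[ℝ]) := by
      conv_lhs => rw [← Quaternion.re_add_im q, hq, add_zero]
    rw [h1]
    apply differentiableAt_intr_of_real hφ
    rwa [param, hq, norm_zero] at hd
  · have h1 : DifferentiableAt ℝ (fun q => φ (param q)) q :=
      (hd.restrictScalars ℝ).comp q (differentiableAt_param hq)
    have h2 := (differentiableAt_im q).norm ℝ hq
    have h3 : DifferentiableAt ℝ (fun q : ℍ[ℝ] => ‖q.im‖⁻¹ • q.im) q :=
      (h2.inv (norm_ne_zero_iff.2 hq)).smul (differentiableAt_im q)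
    have h4 : DifferentiableAt ℝ (fun q : ℍ[ℝ] => ((φ (param q)).re : ℍ[ℝ])) q := by
      simp only [coe_eq_smul_one]
      exact (Complex.reCLM.differentiableAt.comp q h1).smul_const _
    have h5 : DifferentiableAt ℝ (fun q : ℍ[ℝ] => ((φ (param q)).im : ℍ[ℝ])) q := by
      simp only [coe_eq_smul_one]
      exact (Complex.imCLM.differentiableAt.comp q h1).smul_const _
    exact h4.add (h3.mul h5)

/-- The slice function with stem function `Φ`. -/
def ofStem (Φ : ℂ → ℍ[ℂ]) (q : ℍ[ℝ]) : ℍ[ℝ] := ∑ k, intr (fun z => cf k (Φ z)) q * eb k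

lemma HolStem.cf_conj {r : ℝ} {Φ : ℂ → ℍ[ℂ]} (hΦ : HolStem r Φ) (k : Fin 4) (z : ℂ) :
    cf k (Φ (starRingEnd ℂ z)) = starRingEnd ℂ (cf k (Φ z)) := by
  rw [hΦ.symm, cf_cconj]

lemma sum_slice_cf {J : ℍ[ℝ]} (w : ℍ[ℂ]) : ∑ k, slice J (cf k w) * eb k = ev J w := by
  rw [ev]
  conv_rhs => rw [← sum_cf_smul_eb (rePart w), ← sum_cf_smul_eb (imPart w)]
  rw [Finset.mul_sum, ← Finset.sum_add_distrib]
  refine Finset.sum_congr rfl fun k _ => ?_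
  rw [slice_apply, pt, add_mul, Quaternion.coe_mul_eq_smul, mul_assoc, Quaternion.coe_mul_eq_smul,
    cf_rePart, cf_imPart]

lemma ofStem_slice {r : ℝ} {Φ : ℂ → ℍ[ℂ]} (hΦ : HolStem r Φ) {J : ℍ[ℝ]} (hJ : J ∈ imagUnits)
    (z : ℂ) : ofStem Φ (slice J z) = ev J (Φ z) := by
  rw [ofStem, ← sum_slice_cf]
  refine Finset.sum_congr rfl fun k _ => ?_
  rw [intr_slice (hΦ.cf_conj k) hJ]

lemma stem_ofStem {r : ℝ} {Φ : ℂ → ℍ[ℂ]} (hΦ : HolStem r Φ) (z : ℂ) :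
    stem (ofStem Φ) z = Φ z := by
  apply stem_eq_of_ev
  · rw [← slice_apply, ofStem_slice hΦ unitI_mem]
  · rw [← hΦ.symm, ← ofStem_slice hΦ unitI_mem, slice_apply]; rfl

/-- On `ℂ_J` the function is a sum of holomorphic `ℂ_J`-valued functions times constants on the
right, and right multiplication commutes with the left action of `J` in the Cauchy–Riemann
condition. -/
lemma HolStem.sliceRegularOn {r : ℝ} {Φ : ℂ → ℍ[ℂ]} (hΦ : HolStem r Φ) :
    SliceRegularOn (ofStem Φ) (ball 0 r) := by
  have hpar : ∀ q ∈ ball (0 : ℍ[ℝ]) r, param q ∈ ball (0 : ℂ) r := by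
    intro q hq; simpa [norm_param] using hq
  have hda : ∀ k, ∀ z ∈ ball (0 : ℂ) r, DifferentiableAt ℂ (fun z => cf k (Φ z)) z :=
    fun k z hz => (hΦ.diff k z hz).differentiableAt (isOpen_ball.mem_nhds hz)
  have hd : ∀ q ∈ ball (0 : ℍ[ℝ]) r, ∀ k,
      DifferentiableAt ℝ (intr (fun z => cf k (Φ z))) q := fun q hq k =>
    differentiableAt_intr (hΦ.cf_conj k) (hda k _ (hpar q hq))
  have hD : ∀ q ∈ ball (0 : ℍ[ℝ]) r, DifferentiableAt ℝ (ofStem Φ) q := fun q hq =>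
    DifferentiableAt.fun_sum fun k _ => (hd q hq k).mul_const _
  refine ⟨fun q hq => (hD q hq).differentiableWithinAt, fun J hJ x y hxy => ?_⟩
  set z : ℂ := ⟨x, y⟩
  have hz' : pt J x y = slice J z := by rw [slice_apply]
  rw [hz'] at hxy ⊢
  have hz : z ∈ ball (0 : ℂ) r := (slice_mem_ball hJ).1 hxy
  have h1 := (hD _ hxy).hasFDerivAt.comp z (slice J).hasFDerivAt
  have h2 : ofStem Φ ∘ slice J = fun z => ∑ k, slice J (cf k (Φ z)) * eb k := by
    ext1 z
    rw [Function.comp_apply, ofStem_slice hΦ hJ, sum_slice_cf]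
  have h3 : HasFDerivAt (fun z => ∑ k, slice J (cf k (Φ z)) * eb k)
      (∑ k, ((ContinuousLinearMap.mul ℝ ℍ[ℝ]).flip (eb k)).comp ((slice J).comp
        ((fderiv ℂ (fun z => cf k (Φ z)) z).restrictScalars ℝ))) z :=
    HasFDerivAt.fun_sum fun k _ => ((ContinuousLinearMap.mul ℝ ℍ[ℝ]).flip (eb k)).hasFDerivAt.comp z
      ((slice J).hasFDerivAt.comp z ((hda k z hz).hasFDerivAt.restrictScalars ℝ))
  rw [h2] at h1
  have h4 := h1.unique h3
  have e1 := DFunLike.congr_fun h4 1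
  have e2 := DFunLike.congr_fun h4 Complex.I
  simp only [ContinuousLinearMap.comp_apply, slice_one, slice_I, sum_apply,
    ContinuousLinearMap.flip_apply, ContinuousLinearMap.mul_apply',
    ContinuousLinearMap.coe_restrictScalars'] at e1 e2
  have e3 : ∀ k, slice J (fderiv ℂ (fun z => cf k (Φ z)) z Complex.I) =
      J * slice J (fderiv ℂ (fun z => cf k (Φ z)) z 1) := by
    intro k
    have : fderiv ℂ (fun z => cf k (Φ z)) z Complex.I =
        Complex.I * fderiv ℂ (fun z => cf k (Φ z)) z 1 := by
      conv_lhs => rw [show Complex.I = Complex.I • (1 : ℂ) by simp, map_smul]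
      simp
    rw [this, slice_apply, ← pt_mul_pt hJ, slice_apply]
    simp [pt]
  simp only [e3, mul_assoc, ← Finset.mul_sum] at e2
  rw [← e1] at e2
  rw [e2, ← mul_assoc, mul_self_of_mem_imagUnits hJ]
  simp

/-! ### Division by real and quaternionic factors -/

/-- The real quadratic polynomial with roots `ζ` and `conj ζ`. -/
def quad (ζ z : ℂ) : ℂ := (z - ζ) * (z - starRingEnd ℂ ζ)

lemma quad_eq (ζ z : ℂ) : (z - (ζ.re : ℂ)) ^ 2 + (ζ.im : ℂ) ^ 2 = quad ζ z := by
  apply Complex.ext <;> simp [quad, sq] <;> ring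

lemma quad_conj (ζ z : ℂ) : quad ζ (starRingEnd ℂ z) = starRingEnd ℂ (quad ζ z) := by
  simp [quad, mul_comm]

lemma eqOn_of_sub_mul_eq {φ ψ : ℂ → ℂ} {U : Set ℂ} (hU : IsOpen U) (hφ : ContinuousOn φ U)
    (hψ : ContinuousOn ψ U) (c : ℂ) (h : ∀ z ∈ U, (z - c) * φ z = (z - c) * ψ z) :
    Set.EqOn φ ψ U := by
  intro z hz
  have h1 := (hφ.continuousAt (hU.mem_nhds hz)).eventuallyEq_nhds_iff_eventuallyEq_nhdsNE
    (hψ.continuousAt (hU.mem_nhds hz))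
  refine (h1.1 ?_).eq_of_nhds
  have h2 : ∀ᶠ w in 𝓝[≠] z, w ≠ c := by
    by_cases hzc : z = c
    · rw [hzc]; exact eventually_mem_nhdsWithin
    · exact eventually_nhdsWithin_of_eventually_nhds (isOpen_ne.mem_nhds hzc)
  filter_upwards [h2, eventually_nhdsWithin_of_eventually_nhds (hU.mem_nhds hz)] with w hw hwU
  exact mul_left_cancel₀ (sub_ne_zero.2 hw) (h w hwU)

lemma eqOn_of_quad_mul_eq {r : ℝ} {Φ Ψ : ℂ → ℍ[ℂ]} (hΦ : HolStem r Φ) (hΨ : HolStem r Ψ) (ζ : ℂ)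
    (h : ∀ z ∈ ball (0 : ℂ) r, ((quad ζ z : ℂ) : ℍ[ℂ]) * Φ z = ((quad ζ z : ℂ) : ℍ[ℂ]) * Ψ z) :
    Set.EqOn Φ Ψ (ball 0 r) := by
  intro z hz
  refine cf_ext fun k => ?_
  have hc : ∀ {Φ : ℂ → ℍ[ℂ]}, HolStem r Φ → ContinuousOn (fun z => cf k (Φ z)) (ball 0 r) :=
    fun h => (h.diff k).continuousOn
  have hm : ∀ {Φ : ℂ → ℍ[ℂ]}, HolStem r Φ →
      ContinuousOn (fun z => (z - starRingEnd ℂ ζ) * cf k (Φ z)) (ball 0 r) := fun h => by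
    have := hc h
    fun_prop
  refine eqOn_of_sub_mul_eq isOpen_ball (hc hΦ) (hc hΨ) (starRingEnd ℂ ζ) ?_ hz
  intro w hw
  refine eqOn_of_sub_mul_eq isOpen_ball (hm hΦ) (hm hΨ) ζ ?_ hw
  intro v hv
  have := congrArg (cf k) (h v hv)
  rw [cf_coe_mul, cf_coe_mul, quad] at this
  rw [← mul_assoc, ← mul_assoc, this]

lemma exists_sub_mul {φ : ℂ → ℂ} {U : Set ℂ} (hU : IsOpen U) (hφ : DifferentiableOn ℂ φ U) {c : ℂ}
    (hc : c ∈ U) (h0 : φ c = 0) :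
    ∃ ψ : ℂ → ℂ, DifferentiableOn ℂ ψ U ∧ ∀ z, φ z = (z - c) * ψ z := by
  refine ⟨dslope φ c, (Complex.differentiableOn_dslope (hU.mem_nhds hc)).2 hφ, fun z => ?_⟩
  rw [← smul_eq_mul, sub_smul_dslope, h0, sub_zero]

/-- The complexified quaternion with given coefficients. -/
def ofCf (c : Fin 4 → ℂ) : ℍ[ℂ] := ⟨c 0, c 1, c 2, c 3⟩

lemma cf_ofCf (c : Fin 4 → ℂ) (k : Fin 4) : cf k (ofCf c) = c k := by
  fin_cases k <;> rfl

/-- The quotients `ψ k` need not be symmetric under conjugation, which a stem function must be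
everywhere. Averaging with `conj ∘ ψ ∘ conj` repairs this without changing the product, because `Φ`
and `p` are symmetric. -/
lemma HolStem.exists_mul {r : ℝ} {Φ : ℂ → ℍ[ℂ]} (hΦ : HolStem r Φ) {p : ℂ → ℂ}
    (hp : ∀ z, p (starRingEnd ℂ z) = starRingEnd ℂ (p z))
    (h : ∀ k, ∃ ψ : ℂ → ℂ, DifferentiableOn ℂ ψ (ball 0 r) ∧ ∀ z, cf k (Φ z) = p z * ψ z) :
    ∃ Ψ : ℂ → ℍ[ℂ], HolStem r Ψ ∧ ∀ z, Φ z = (p z : ℍ[ℂ]) * Ψ z := by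
  choose ψ hψ hψe using h
  refine ⟨fun z => ofCf fun k => (1 / 2 : ℂ) * (ψ k z + starRingEnd ℂ (ψ k (starRingEnd ℂ z))),
    ⟨fun k => ?_, fun z => ?_⟩, fun z => ?_⟩
  · simp only [cf_ofCf]
    refine DifferentiableOn.const_mul ((hψ k).add fun z hz => ?_) _
    have h2 := ((hψ k).differentiableAt (isOpen_ball.mem_nhds (conj_mem_ball hz))).conj_conj
    rw [Complex.conj_conj] at h2
    exact h2.differentiableWithinAt
  · refine cf_ext fun k => ?_
    rw [cf_cconj, cf_ofCf, cf_ofCf]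
    simp only [map_mul, map_add, Complex.conj_conj, map_div₀, map_one, map_ofNat]
    ring
  · refine cf_ext fun k => ?_
    rw [cf_coe_mul, cf_ofCf]
    have h1 := hψe k z
    have h2 := congrArg (starRingEnd ℂ) (hψe k (starRingEnd ℂ z))
    rw [hΦ.cf_conj, Complex.conj_conj, map_mul, hp, Complex.conj_conj] at h2
    linear_combination (1 / 2 : ℂ) * h1 + (1 / 2 : ℂ) * h2

lemma HolStem.mul {r : ℝ} {Φ Ψ : ℂ → ℍ[ℂ]} (hΦ : HolStem r Φ) (hΨ : HolStem r Ψ) :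
    HolStem r fun z => Φ z * Ψ z := by
  refine ⟨fun k => ?_, fun z => by rw [hΦ.symm, hΨ.symm, cconj_mul]⟩
  have h1 := hΦ.diff 0
  have h2 := hΦ.diff 1
  have h3 := hΦ.diff 2
  have h4 := hΦ.diff 3
  have h5 := hΨ.diff 0
  have h6 := hΨ.diff 1
  have h7 := hΨ.diff 2
  have h8 := hΨ.diff 3
  simp only [cf, Matrix.cons_val] at h1 h2 h3 h4 h5 h6 h7 h8
  fin_cases k <;> simp [cf] <;> fun_prop

lemma HolStem.diff_normSq {r : ℝ} {Φ : ℂ → ℍ[ℂ]} (hΦ : HolStem r Φ) :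
    DifferentiableOn ℂ (fun z => Quaternion.normSq (Φ z)) (ball 0 r) := by
  have h1 := hΦ.diff 0
  have h2 := hΦ.diff 1
  have h3 := hΦ.diff 2
  have h4 := hΦ.diff 3
  simp only [cf, Matrix.cons_val] at h1 h2 h3 h4
  simp only [Quaternion.normSq_def']
  fun_prop

lemma holStem_lin (r : ℝ) (a : ℍ[ℝ]) : HolStem r (lin a) := by
  refine ⟨fun k => ?_, fun z => by rw [← stem_sub, ← stem_sub, stem_conj]⟩
  have : (fun z => cf k (lin a z)) = fun z => (if k = 0 then z else 0) - ((cf k a : ℝ) : ℂ) := by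
    ext z
    rw [lin, cf_cx]
    fin_cases k <;> simp [cf] <;> apply Complex.ext <;> simp
  rw [this]
  split_ifs <;> fun_prop

/-- By symmetry the coefficients vanish at `conj ζ` too. Since `conj ζ ≠ ζ`, the quotient by `z - ζ`
still vanishes there and can be divided again. -/
lemma HolStem.exists_quad_mul {r : ℝ} {Φ : ℂ → ℍ[ℂ]} (hΦ : HolStem r Φ) {ζ : ℂ}
    (hζ : ζ ∈ ball (0 : ℂ) r) (him : ζ.im ≠ 0) (h0 : Φ ζ = 0) :
    ∃ Ψ : ℂ → ℍ[ℂ], HolStem r Ψ ∧ ∀ z, Φ z = ((quad ζ z : ℂ) : ℍ[ℂ]) * Ψ z := by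
  refine hΦ.exists_mul (quad_conj ζ) fun k => ?_
  have hk : cf k (Φ ζ) = 0 := by rw [h0]; fin_cases k <;> rfl
  obtain ⟨ψ, hψ, h1⟩ := exists_sub_mul isOpen_ball (hΦ.diff k) hζ hk
  have h2 : ψ (starRingEnd ℂ ζ) = 0 := by
    have h3 := h1 (starRingEnd ℂ ζ)
    rw [hΦ.cf_conj, hk, map_zero] at h3
    refine (mul_eq_zero.1 h3.symm).resolve_left fun h => him ?_
    have := congrArg Complex.im h
    simp at this
    linarith
  obtain ⟨χ, hχ, h3⟩ := exists_sub_mul isOpen_ball hψ (conj_mem_ball hζ) h2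
  exact ⟨χ, hχ, fun z => by rw [h1, h3, quad, mul_assoc]⟩

/-- A slice regular function that vanishes on a sphere is divisible by its quadratic polynomial. -/
lemma SliceRegularOn.exists_quad_mul {f : ℍ[ℝ] → ℍ[ℝ]} {r : ℝ} (hf : SliceRegularOn f (ball 0 r))
    {ζ : ℂ} (hζ : ζ ∈ ball (0 : ℂ) r) (him : ζ.im ≠ 0) (h0 : stem f ζ = 0) :
    ∃ g, SliceRegularOn g (ball 0 r) ∧ ∀ z, stem f z = ((quad ζ z : ℂ) : ℍ[ℂ]) * stem g z := by
  obtain ⟨Ψ, hΨ, h⟩ := hf.holStem.exists_quad_mul hζ him h0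
  exact ⟨ofStem Ψ, hΨ.sliceRegularOn, fun z => by rw [stem_ofStem hΨ, h]⟩

lemma SliceRegularOn.exists_sub_real_mul {f : ℍ[ℝ] → ℍ[ℝ]} {r : ℝ}
    (hf : SliceRegularOn f (ball 0 r)) {a : ℝ} (ha : (a : ℂ) ∈ ball (0 : ℂ) r)
    (h0 : stem f a = 0) :
    ∃ g, SliceRegularOn g (ball 0 r) ∧ ∀ z, stem f z = ((z - a : ℂ) : ℍ[ℂ]) * stem g z := by
  obtain ⟨Ψ, hΨ, h⟩ := hf.holStem.exists_mul (p := fun z => z - a) (fun z => by simp) fun k => by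
    refine exists_sub_mul isOpen_ball (hf.holStem.diff k) ha ?_
    rw [h0]; fin_cases k <;> rfl
  exact ⟨ofStem Ψ, hΨ.sliceRegularOn, fun z => by rw [stem_ofStem hΨ, h]⟩

/-- Zero divisors of `ℍ[ℂ]`: `ev K w = 0` means `w = (i - K) b`, the linear factor of the conjugate
point has the value `y (i + K)` at `ζ`, and `(i + K)(i - K) = -1 - K² = 0`. -/
lemma lin_neg_mul_eq_zero {K : ℍ[ℝ]} (hK : K ∈ imagUnits) {ζ : ℂ} {w : ℍ[ℂ]} (h : ev K w = 0) :
    lin (pt (-K) ζ.re ζ.im) ζ * w = 0 := by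
  rw [ev] at h
  have hw : w = cx (-(K * imPart w)) (imPart w) := by
    rw [← eq_neg_iff_add_eq_zero.2 h]; rfl
  have hc : ∀ q : ℍ[ℝ], q * (ζ.im : ℍ[ℝ]) = (ζ.im : ℍ[ℝ]) * q :=
    fun q => (Quaternion.coe_commutes _ _).symm
  rw [hw, lin, pt, cx_mul, hc, ← cx_zero]
  generalize imPart w = b
  congr 1
  · calc _ = (ζ.im : ℍ[ℝ]) * (-(K * K)) * b - (ζ.im : ℍ[ℝ]) * b := by noncomm_ring
      _ = 0 := by rw [mul_self_of_mem_imagUnits hK]; noncomm_ring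
  · noncomm_ring

/-- A slice regular function that vanishes at a nonreal point is divisible by the corresponding
linear factor. -/
lemma SliceRegularOn.exists_lin_mul {f : ℍ[ℝ] → ℍ[ℝ]} {r : ℝ} (hf : SliceRegularOn f (ball 0 r))
    {ζ : ℂ} (hζ : ζ ∈ ball (0 : ℂ) r) (him : ζ.im ≠ 0) {K : ℍ[ℝ]} (hK : K ∈ imagUnits)
    (h0 : ev K (stem f ζ) = 0) :
    ∃ g, SliceRegularOn g (ball 0 r) ∧
      ∀ z ∈ ball (0 : ℂ) r, stem f z = lin (pt K ζ.re ζ.im) z * stem g z := by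
  -- Multiplying on the left by the conjugate linear factor gives a stem function vanishing at `ζ`,
  -- hence a multiple of the quadratic. Multiplying by the linear factor itself and cancelling the
  -- quadratic gives the factorization.
  obtain ⟨Ψ, hΨ, h⟩ := ((holStem_lin r (pt (-K) ζ.re ζ.im)).mul hf.holStem).exists_quad_mul hζ him
    (lin_neg_mul_eq_zero hK h0)
  refine ⟨ofStem Ψ, hΨ.sliceRegularOn, fun z hz => ?_⟩
  rw [stem_ofStem hΨ]
  refine eqOn_of_quad_mul_eq hf.holStem ((holStem_lin r _).mul hΨ) ζ (fun w _ => ?_) hz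
  rw [← mul_assoc, Quaternion.coe_commutes _ (lin _ _), mul_assoc, ← h, ← mul_assoc,
    lin_mul_lin_star hK, quad_eq]

lemma normSq_eq (w : ℍ[ℂ]) : Quaternion.normSq w =
    ⟨Quaternion.normSq (rePart w) - Quaternion.normSq (imPart w),
      2 * (rePart w * star (imPart w)).re⟩ := by
  simp only [Quaternion.normSq_def', Quaternion.re_mul, sq]
  apply Complex.ext <;> simp <;> ring

/-- If the norm form of a nonzero stem value vanishes then the function has a zero on the
sphere. -/
lemma exists_ev_eq_zero {w : ℍ[ℂ]} (hw : w ≠ 0) (h : Quaternion.normSq w = 0) :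
    ∃ K ∈ imagUnits, ev K w = 0 := by
  rw [normSq_eq] at h
  have h1 : Quaternion.normSq (rePart w) - Quaternion.normSq (imPart w) = 0 := congrArg Complex.re h
  have h2 : 2 * (rePart w * star (imPart w)).re = 0 := congrArg Complex.im h
  have hb : imPart w ≠ 0 := by
    intro hb
    rw [hb, map_zero, sub_zero, Quaternion.normSq_eq_zero] at h1
    apply hw
    rw [← cx_rePart_imPart w, hb, h1, cx_zero]
  -- The solution of `a + K b = 0` is `K = -a b⁻¹`. The two components of `normSq w = 0` say that
  -- `Re (a * star b) = 0` and `|a| = |b|`, exactly what makes `K` an imaginary unit.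
  refine ⟨-(rePart w * (imPart w)⁻¹), ⟨?_, ?_⟩, ?_⟩
  · rw [Quaternion.inv_def, mul_smul_comm, Quaternion.re_neg, Quaternion.re_smul,
      (mul_eq_zero.1 h2).resolve_left two_ne_zero, smul_zero, neg_zero]
  · rw [norm_neg, norm_mul, norm_inv]
    rw [sub_eq_zero, Quaternion.normSq_eq_norm_mul_self, Quaternion.normSq_eq_norm_mul_self,
      mul_self_inj (norm_nonneg _) (norm_nonneg _)] at h1
    rw [h1, mul_inv_cancel₀ (norm_ne_zero_iff.2 hb)]
  · rw [ev, neg_mul, mul_assoc, inv_mul_cancel₀ hb, mul_one, add_neg_cancel]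

lemma ev_inj {J : ℍ[ℝ]} {w : ℍ[ℂ]} (h1 : ev J w = 0) (h2 : ev (-J) w = 0) (hJ : J ∈ imagUnits) :
    w = 0 := by
  rw [ev] at h1 h2
  have h3 : (2 : ℝ) • rePart w = 0 := by
    rw [two_smul]
    calc _ = (rePart w + J * imPart w) + (rePart w + -J * imPart w) := by noncomm_ring
      _ = 0 := by rw [h1, h2, add_zero]
  have h4 := (smul_eq_zero.1 h3).resolve_left two_ne_zero
  rw [h4, zero_add] at h1
  have hJ0 : J ≠ 0 := by rintro rfl; simpa using hJ.2
  rw [← cx_rePart_imPart w, h4, (mul_eq_zero.1 h1).resolve_left hJ0, cx_zero]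

lemma HolStem.const_mul {r : ℝ} {Φ : ℂ → ℍ[ℂ]} (hΦ : HolStem r Φ) {p : ℂ → ℂ}
    (hp : ∀ z, p (starRingEnd ℂ z) = starRingEnd ℂ (p z)) (hd : Differentiable ℂ p) :
    HolStem r fun z => (p z : ℍ[ℂ]) * Φ z := by
  refine ⟨fun k => ?_, fun z => ?_⟩
  · simp only [cf_coe_mul]
    exact hd.differentiableOn.mul (hΦ.diff k)
  · refine cf_ext fun k => ?_
    rw [cf_cconj, cf_coe_mul, cf_coe_mul, hp, hΦ.cf_conj, map_mul]

lemma differentiable_quad_pow (ζ : ℂ) (m : ℕ) : Differentiable ℂ fun z => quad ζ z ^ m := by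
  unfold quad; fun_prop

lemma HolStem.quad_pow_mul {r : ℝ} {Φ : ℂ → ℍ[ℂ]} (hΦ : HolStem r Φ) (ζ : ℂ) (m : ℕ) :
    HolStem r fun z => ((quad ζ z ^ m : ℂ) : ℍ[ℂ]) * Φ z :=
  hΦ.const_mul (fun z => by rw [quad_conj, map_pow]) (differentiable_quad_pow ζ m)

lemma holStem_linProd_mul {r : ℝ} {Φ : ℂ → ℍ[ℂ]} (hΦ : HolStem r Φ) (L : List ℍ[ℝ]) :
    HolStem r fun z => linProd L z * Φ z := by
  induction L with
  | nil => simpa [linProd] using hΦ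
  | cons a L ih =>
    have := (holStem_lin r a).mul ih
    simpa [linProd, mul_assoc] using this

lemma eqOn_of_quad_pow_mul_eq {r : ℝ} {ζ : ℂ} (m : ℕ) {Φ Ψ : ℂ → ℍ[ℂ]}
    (hΦ : HolStem r Φ) (hΨ : HolStem r Ψ)
    (h : ∀ z ∈ ball (0 : ℂ) r,
      ((quad ζ z ^ m : ℂ) : ℍ[ℂ]) * Φ z = ((quad ζ z ^ m : ℂ) : ℍ[ℂ]) * Ψ z) :
    Set.EqOn Φ Ψ (ball 0 r) := by
  induction m with
  | zero => intro z hz; simpa using h z hz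
  | succ m ih =>
    refine ih fun z hz => ?_
    refine eqOn_of_quad_mul_eq (hΦ.quad_pow_mul ζ m) (hΨ.quad_pow_mul ζ m) ζ (fun w hw => ?_) hz
    have := h w hw
    rwa [pow_succ', Quaternion.coe_mul, mul_assoc, mul_assoc] at this

lemma quad_self (ζ : ℂ) : quad ζ ζ = 0 := by simp [quad]

lemma quad_pow_unique_of_le {r : ℝ} {ζ : ℂ} (hζ : ζ ∈ ball (0 : ℂ) r) {m n : ℕ} (hmn : m ≤ n)
    {Φ Ψ : ℂ → ℍ[ℂ]} (hΦ : HolStem r Φ) (hΨ : HolStem r Ψ) (hΦ0 : Φ ζ ≠ 0)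
    (h : ∀ z ∈ ball (0 : ℂ) r,
      ((quad ζ z ^ m : ℂ) : ℍ[ℂ]) * Φ z = ((quad ζ z ^ n : ℂ) : ℍ[ℂ]) * Ψ z) :
    m = n ∧ Set.EqOn Φ Ψ (ball 0 r) := by
  obtain ⟨k, rfl⟩ := Nat.exists_eq_add_of_le hmn
  have h1 := eqOn_of_quad_pow_mul_eq m hΦ (hΨ.quad_pow_mul ζ k) fun z hz => by
    rw [h z hz, pow_add, Quaternion.coe_mul, mul_assoc]
  have hk : k = 0 := by
    by_contra hk
    apply hΦ0
    have := h1 hζ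
    simpa [quad_self, hk] using this
  subst hk
  exact ⟨rfl, fun z hz => by simpa using h1 hz⟩

lemma quad_pow_unique {r : ℝ} {ζ : ℂ} (hζ : ζ ∈ ball (0 : ℂ) r) {m n : ℕ}
    {Φ Ψ : ℂ → ℍ[ℂ]} (hΦ : HolStem r Φ) (hΨ : HolStem r Ψ) (hΦ0 : Φ ζ ≠ 0) (hΨ0 : Ψ ζ ≠ 0)
    (h : ∀ z ∈ ball (0 : ℂ) r,
      ((quad ζ z ^ m : ℂ) : ℍ[ℂ]) * Φ z = ((quad ζ z ^ n : ℂ) : ℍ[ℂ]) * Ψ z) :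
    m = n ∧ Set.EqOn Φ Ψ (ball 0 r) := by
  rcases le_total m n with hmn | hmn
  · exact quad_pow_unique_of_le hζ hmn hΦ hΨ hΦ0 h
  · have := quad_pow_unique_of_le hζ hmn hΨ hΦ hΨ0 fun z hz => (h z hz).symm
    exact ⟨this.1.symm, this.2.symm⟩

/-! ### Normal forms along a nonreal sphere -/

/-- A factorization of `f` along the sphere of `ζ` into linear factors, a power of the quadratic
polynomial, and a factor without zeros on the sphere. -/
structure IsNormalForm (f : ℍ[ℝ] → ℍ[ℝ]) (r : ℝ) (ζ : ℂ) (L : List ℍ[ℝ]) (m : ℕ)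
    (g : ℍ[ℝ] → ℍ[ℝ]) : Prop where
  regular : SliceRegularOn g (ball 0 r)
  mem : ∀ p ∈ L, p ∈ sphereAt ζ.re ζ.im
  chain : List.IsChain (fun p p' => star p' ≠ p) L
  ne_zero : ∀ K ∈ imagUnits, ev K (stem g ζ) ≠ 0
  eq : ∀ z ∈ ball (0 : ℂ) r,
    stem f z = linProd L z * (((quad ζ z ^ m : ℂ) : ℍ[ℂ]) * stem g z)

/-- By `ev_lin_mul`, `C` is the value of the remaining product at `conj a`. Inductively that product
vanishes on the sphere at most at its own head `b`, and the chain condition says `b ≠ conj a`. So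
the whole product vanishes at `a` and, for a nonreal sphere, nowhere else on it. -/
lemma ev_linProd_cons {ζ : ℂ} {w : ℍ[ℂ]} (hw : ∀ K ∈ imagUnits, ev K w ≠ 0) (L : List ℍ[ℝ])
    (a : ℍ[ℝ]) (hL : ∀ p ∈ a :: L, p ∈ sphereAt ζ.re ζ.im)
    (hc : List.IsChain (fun p p' => star p' ≠ p) (a :: L)) :
    ∃ C : ℍ[ℝ], C ≠ 0 ∧ ∀ J ∈ imagUnits,
      ev J (linProd (a :: L) ζ * w) = (pt J ζ.re ζ.im - a) * C := by
  induction L generalizing a with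
  | nil =>
    obtain ⟨K, hK, rfl⟩ := hL a (by simp)
    refine ⟨ev (-K) w, hw _ (neg_mem_imagUnits hK), fun J hJ => ?_⟩
    rw [← ev_lin_mul hJ hK]
    simp [linProd]
  | cons b L ih =>
    obtain ⟨C, hC, h⟩ := ih b (fun p hp => hL p (List.mem_cons_of_mem _ hp)) hc.tail
    obtain ⟨K, hK, rfl⟩ := hL a (by simp)
    refine ⟨ev (-K) (linProd (b :: L) ζ * w), ?_, fun J hJ => ?_⟩
    · rw [h _ (neg_mem_imagUnits hK)]
      refine mul_ne_zero (fun h0 => ?_) hC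
      have h1 := List.isChain_cons_cons.1 hc
      apply h1.1
      rw [← sub_eq_zero.1 h0, star_pt (neg_mem_imagUnits hK), neg_neg]
    · rw [← ev_lin_mul hJ hK]
      simp [linProd, mul_assoc]

variable {f g h : ℍ[ℝ] → ℍ[ℝ]} {r R : ℝ} {ζ : ℂ} {L : List ℍ[ℝ]} {m : ℕ}

lemma IsNormalForm.eq' (h : IsNormalForm f r ζ L m g) {z : ℂ} (hz : z ∈ ball (0 : ℂ) r) :
    stem f z = ((quad ζ z ^ m : ℂ) : ℍ[ℂ]) * (linProd L z * stem g z) := by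
  rw [h.eq z hz, ← mul_assoc, ← mul_assoc, Quaternion.coe_commutes]

lemma imagUnits_exists_ne (a : ℍ[ℝ]) {ζ : ℂ} (him : ζ.im ≠ 0) :
    ∃ J ∈ imagUnits, pt J ζ.re ζ.im ≠ a := by
  by_contra! h
  have h1 := h _ unitI_mem
  have h2 := h _ (neg_mem_imagUnits unitI_mem)
  have h3 := congrArg QuaternionAlgebra.imI (h1.trans h2.symm)
  simp [pt, show unitI.imI = 1 from rfl] at h3
  apply him
  linarith

lemma IsNormalForm.cofactor_ne_zero (h : IsNormalForm f r ζ L m g) (him : ζ.im ≠ 0) :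
    linProd L ζ * stem g ζ ≠ 0 := by
  intro h0
  cases L with
  | nil =>
    apply h.ne_zero _ unitI_mem
    rw [linProd, List.map_nil, List.prod_nil, one_mul] at h0
    rw [h0, ← cx_zero]; simp [ev]
  | cons a L =>
    obtain ⟨C, hC, h1⟩ := ev_linProd_cons h.ne_zero L a h.mem h.chain
    obtain ⟨J, hJ, h2⟩ := imagUnits_exists_ne a him
    refine mul_ne_zero (sub_ne_zero.2 h2) hC ?_
    rw [← h1 J hJ, h0, ← cx_zero]
    simp [ev]

lemma IsNormalForm.unique {L' : List ℍ[ℝ]} {m' : ℕ} {g' : ℍ[ℝ] → ℍ[ℝ]}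
    (hζ : ζ ∈ ball (0 : ℂ) r) (him : ζ.im ≠ 0) (h : IsNormalForm f r ζ L m g)
    (h' : IsNormalForm f r ζ L' m' g') :
    m = m' ∧ linProd L ζ * stem g ζ = linProd L' ζ * stem g' ζ := by
  have := quad_pow_unique hζ (holStem_linProd_mul h.regular.holStem L)
    (holStem_linProd_mul h'.regular.holStem L') (h.cofactor_ne_zero him) (h'.cofactor_ne_zero him)
    fun z hz => by rw [← h.eq' hz, ← h'.eq' hz]
  exact ⟨this.1, this.2 hζ⟩

/-- The value at `ζ` of the product without the quadratic power is the same for all normal forms,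
and the head of the list is the only zero of its evaluations on the sphere. -/
lemma IsNormalForm.head_unique {L' : List ℍ[ℝ]} {m' : ℕ} {g' : ℍ[ℝ] → ℍ[ℝ]} {a : ℍ[ℝ]}
    (hζ : ζ ∈ ball (0 : ℂ) r) (him : ζ.im ≠ 0) (h : IsNormalForm f r ζ L m g)
    (h' : IsNormalForm f r ζ (a :: L') m' g') : L.head? = some a := by
  have h1 := (h.unique hζ him h').2
  obtain ⟨C, hC, h2⟩ := ev_linProd_cons h'.ne_zero L' a h'.mem h'.chain
  obtain ⟨J, hJ, rfl⟩ := h'.mem a (by simp)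
  have h3 := h2 J hJ
  rw [sub_self, zero_mul, ← h1] at h3
  cases L with
  | nil =>
    rw [linProd, List.map_nil, List.prod_nil, one_mul] at h3
    exact absurd h3 (h.ne_zero J hJ)
  | cons b L =>
    obtain ⟨C', hC', h4⟩ := ev_linProd_cons h.ne_zero L b h.mem h.chain
    rw [h4 J hJ] at h3
    rw [List.head?_cons, sub_eq_zero.1 ((mul_eq_zero.1 h3).resolve_right hC')]

lemma normSq_linProd {L : List ℍ[ℝ]} {ζ : ℂ} (hL : ∀ p ∈ L, p ∈ sphereAt ζ.re ζ.im) (z : ℂ) :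
    Quaternion.normSq (linProd L z) = quad ζ z ^ L.length := by
  induction L with
  | nil => simp [linProd]
  | cons a L ih =>
    obtain ⟨K, hK, rfl⟩ := hL a (by simp)
    rw [linProd, List.map_cons, List.prod_cons, map_mul, ← linProd,
      ih fun p hp => hL p (List.mem_cons_of_mem _ hp), normSq_lin hK, quad_eq, List.length_cons,
      pow_succ']

lemma SliceRegularOn.analyticAt_stemNorm (hf : SliceRegularOn f (ball 0 r)) {z : ℂ}
    (hz : z ∈ ball (0 : ℂ) r) : AnalyticAt ℂ (stemNorm f) z :=
  hf.holStem.diff_normSq.analyticOnNhd isOpen_ball z hz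

lemma stemNorm_ne_zero (h : ∀ K ∈ imagUnits, ev K (stem f ζ) ≠ 0) : stemNorm f ζ ≠ 0 := by
  intro h0
  by_cases hw : stem f ζ = 0
  · apply h _ unitI_mem
    rw [hw, ← cx_zero]; simp [ev]
  · obtain ⟨K, hK, h1⟩ := exists_ev_eq_zero hw h0
    exact h K hK h1

/-- For nonreal `ζ` the quadratic has a simple zero at `ζ`; its other factor is nonzero there. -/
lemma analyticOrderAt_of_quad_factor (hf : SliceRegularOn f (ball 0 r))
    (hg : SliceRegularOn g (ball 0 r)) (hζ : ζ ∈ ball (0 : ℂ) r) (him : ζ.im ≠ 0) {n : ℕ}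
    (h0 : stemNorm g ζ ≠ 0)
    (h : ∀ z ∈ ball (0 : ℂ) r, stemNorm f z = quad ζ z ^ n * stemNorm g z) :
    analyticOrderAt (stemNorm f) ζ = n := by
  have hne : ζ - starRingEnd ℂ ζ ≠ 0 := by
    intro h0
    have := congrArg Complex.im h0
    simp at this
    apply him; linarith
  rw [(hf.analyticAt_stemNorm hζ).analyticOrderAt_eq_natCast]
  refine ⟨fun z => (z - starRingEnd ℂ ζ) ^ n * stemNorm g z, ?_, ?_, ?_⟩
  · have := hg.analyticAt_stemNorm hζ
    fun_prop
  · exact mul_ne_zero (pow_ne_zero _ hne) h0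
  · filter_upwards [isOpen_ball.mem_nhds hζ] with z hz
    rw [h z hz, quad, smul_eq_mul, mul_pow, mul_assoc]

/-- Each linear factor contributes the quadratic once, each quadratic factor twice: the source of
the weight two of spherical zeros. -/
lemma IsNormalForm.stemNorm_eq (h : IsNormalForm f r ζ L m g) {z : ℂ} (hz : z ∈ ball (0 : ℂ) r) :
    stemNorm f z = quad ζ z ^ (L.length + 2 * m) * stemNorm g z := by
  rw [stemNorm, h.eq z hz, map_mul, map_mul, normSq_linProd h.mem, Quaternion.normSq_coe, stemNorm,
    pow_add, pow_mul', mul_assoc]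

lemma IsNormalForm.analyticOrderAt_eq (h : IsNormalForm f r ζ L m g)
    (hf : SliceRegularOn f (ball 0 r)) (hζ : ζ ∈ ball (0 : ℂ) r) (him : ζ.im ≠ 0) :
    analyticOrderAt (stemNorm f) ζ = ((L.length + 2 * m : ℕ) : ℕ∞) :=
  analyticOrderAt_of_quad_factor hf h.regular hζ him (stemNorm_ne_zero h.ne_zero)
    fun _ hz => h.stemNorm_eq hz

lemma quad_conj_left (ζ z : ℂ) : quad (starRingEnd ℂ ζ) z = quad ζ z := by
  rw [quad, quad, Complex.conj_conj, mul_comm]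

lemma IsNormalForm.analyticOrderAt_conj_eq (h : IsNormalForm f r ζ L m g)
    (hf : SliceRegularOn f (ball 0 r)) (hζ : ζ ∈ ball (0 : ℂ) r) (him : ζ.im ≠ 0) :
    analyticOrderAt (stemNorm f) (starRingEnd ℂ ζ) = ((L.length + 2 * m : ℕ) : ℕ∞) :=
  analyticOrderAt_of_quad_factor hf h.regular (conj_mem_ball hζ) (by simpa using him)
    (by rw [stemNorm_conj]; simpa using stemNorm_ne_zero h.ne_zero)
    fun _ hz => by rw [h.stemNorm_eq hz, quad_conj_left]

/-- The descent step for the inductions on the order of the norm form. -/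
lemma exists_lt_of_analyticOrderAt_mul {p φ : ℂ → ℂ} (hp : AnalyticAt ℂ p ζ)
    (hφ : AnalyticAt ℂ φ ζ) (h0 : p ζ = 0) {n : ℕ} (h : analyticOrderAt (p * φ) ζ = n) :
    ∃ k < n, analyticOrderAt φ ζ = k := by
  rw [analyticOrderAt_mul hp hφ] at h
  have h1 := hp.analyticOrderAt_ne_zero.2 h0
  generalize analyticOrderAt p ζ = a at *
  generalize analyticOrderAt φ ζ = b at *
  cases a with
  | top => simp at h
  | coe a => cases b with
    | top => simp at h
    | coe b =>
      refine ⟨b, ?_, rfl⟩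
      norm_cast at h h1
      omega

lemma analyticAt_quad (ζ z : ℂ) : AnalyticAt ℂ (quad ζ) z := by
  unfold quad; fun_prop

/-- Split off a quadratic if `f` vanishes on the whole sphere, a linear factor if it has some zero
there, and stop otherwise. Each division lowers the order of the norm form. -/
lemma SliceRegularOn.exists_isNormalForm (hζ : ζ ∈ ball (0 : ℂ) r) (him : ζ.im ≠ 0) (n : ℕ)
    (f : ℍ[ℝ] → ℍ[ℝ]) (hf : SliceRegularOn f (ball 0 r))
    (hn : analyticOrderAt (stemNorm f) ζ = n) : ∃ L m g, IsNormalForm f r ζ L m g := by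
  induction n using Nat.strong_induction_on generalizing f with
  | _ n ih =>
  by_cases h0 : stem f ζ = 0
  · obtain ⟨f', hf', h1⟩ := hf.exists_quad_mul hζ him h0
    have h2 : stemNorm f = quad ζ * (quad ζ * stemNorm f') := by
      ext z
      rw [stemNorm, h1, map_mul, Quaternion.normSq_coe, sq, mul_assoc]; rfl
    have ha := hf'.analyticAt_stemNorm hζ
    rw [h2] at hn
    obtain ⟨k, hk, h3⟩ := exists_lt_of_analyticOrderAt_mul (analyticAt_quad ζ ζ)
      ((analyticAt_quad ζ ζ).mul ha) (quad_self ζ) hn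
    obtain ⟨k', hk', h4⟩ := exists_lt_of_analyticOrderAt_mul (analyticAt_quad ζ ζ) ha
      (quad_self ζ) h3
    obtain ⟨L, m, g, h⟩ := ih k' (hk'.trans hk) f' hf' h4
    refine ⟨L, m + 1, g, h.regular, h.mem, h.chain, h.ne_zero, fun z hz => ?_⟩
    rw [h1, h.eq' hz, pow_succ', Quaternion.coe_mul, ← mul_assoc (linProd L z),
      ← Quaternion.coe_mul, ← Quaternion.coe_commutes, ← mul_assoc, ← mul_assoc, mul_assoc _ _ (stem g z),
      Quaternion.coe_mul]
    simp only [mul_assoc]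
  by_cases h1 : ∀ K ∈ imagUnits, ev K (stem f ζ) ≠ 0
  · exact ⟨[], 0, f, hf, by simp, List.isChain_nil, h1, fun z _ => by simp [linProd]⟩
  push Not at h1
  obtain ⟨K, hK, h1⟩ := h1
  obtain ⟨f', hf', h2⟩ := hf.exists_lin_mul hζ him hK h1
  have h3 : stemNorm f =ᶠ[𝓝 ζ] quad ζ * stemNorm f' := by
    filter_upwards [isOpen_ball.mem_nhds hζ] with z hz
    rw [stemNorm, h2 z hz, map_mul, normSq_lin hK, quad_eq]; rfl
  rw [analyticOrderAt_congr h3] at hn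
  obtain ⟨k, hk, h4⟩ := exists_lt_of_analyticOrderAt_mul (analyticAt_quad ζ ζ)
    (hf'.analyticAt_stemNorm hζ) (quad_self ζ) hn
  obtain ⟨L, m, g, h⟩ := ih k hk f' hf' h4
  -- A remaining quadratic factor would make `f` vanish on the whole sphere, a case already treated.
  -- The same reason excludes a conjugate neighbour in the list below, since two conjugate linear
  -- factors multiply to the quadratic.
  have hm : m = 0 := by
    by_contra hm
    apply h0
    rw [h2 ζ hζ, h.eq ζ hζ, quad_self, zero_pow hm]
    simp
  subst hm
  refine ⟨pt K ζ.re ζ.im :: L, 0, g, h.regular, ?_, ?_, h.ne_zero, fun z hz => ?_⟩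
  · intro p hp
    rcases List.mem_cons.1 hp with rfl | hp
    · exact ⟨K, hK, rfl⟩
    · exact h.mem p hp
  · cases L with
    | nil => exact List.isChain_singleton _
    | cons b L =>
      refine List.isChain_cons_cons.2 ⟨fun hb => h0 ?_, h.chain⟩
      have hb' : b = pt (-K) ζ.re ζ.im := by
        rw [← star_pt hK, ← hb, star_star]
      rw [h2 ζ hζ, h.eq ζ hζ, hb', linProd, List.map_cons, List.prod_cons]
      simp only [← mul_assoc]
      rw [lin_mul_lin_star hK, quad_eq, quad_self]
      simp
  · rw [h2 z hz, h.eq z hz]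
    simp [linProd, mul_assoc]

/-! ### Multiplicities at nonreal spheres -/

lemma stem_congr_of_eqOn {F : ℍ[ℝ] → ℍ[ℝ]} (h : ∀ q ∈ ball (0 : ℍ[ℝ]) r, f q = F q) {z : ℂ}
    (hz : z ∈ ball (0 : ℂ) r) : stem f z = stem F z := by
  apply stem_congr
  · exact h _ ((pt_mem_ball unitI_mem).2 hz)
  · exact h _ ((pt_mem_ball unitI_mem).2 (conj_mem_ball hz))

lemma param_mem_ball {q : ℍ[ℝ]} (hq : q ∈ ball (0 : ℍ[ℝ]) r) : param q ∈ ball (0 : ℂ) r := by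
  simpa [norm_param] using hq

lemma sSup_eq_of_eq_singleton {S : Set ℕ} {n : ℕ} (h : S = {n}) : sSup S = n := by
  rw [h, csSup_singleton]

lemma sphFactor_slice {J : ℍ[ℝ]} (hJ : J ∈ imagUnits) (ζ z : ℂ) :
    sphFactor ζ.re ζ.im (slice J z) = slice J (quad ζ z) := by
  rw [slice_apply, sphFactor_pt hJ, quad_eq, slice_apply]

lemma slice_pow {J : ℍ[ℝ]} (hJ : J ∈ imagUnits) (z : ℂ) (n : ℕ) :
    slice J z ^ n = slice J (z ^ n) := by
  rw [slice_apply, pt_pow hJ, slice_apply]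

/-- Requiring that the cofactor not vanish identically on the sphere fixes the exponent, so the
supremum is over a singleton. The cofactor for `m` is the linear product times `g`, which is nonzero
at `ζ`. -/
lemma IsNormalForm.sphericalMult_eq (h : IsNormalForm f r ζ L m g)
    (hf : SliceRegularOn f (ball 0 r)) (hζ : ζ ∈ ball (0 : ℂ) r) (him : ζ.im ≠ 0) :
    sphericalMult f (ball 0 r) ζ.re ζ.im = m := by
  have hW := holStem_linProd_mul h.regular.holStem L
  apply sSup_eq_of_eq_singleton
  ext n
  simp only [Set.mem_ofPred_eq, Set.mem_singleton_iff]
  constructor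
  · rintro ⟨g', hg', ⟨p, ⟨J, hJ, rfl⟩, hp⟩, he⟩
    have h1 : stem g' ζ ≠ 0 := by
      intro h0
      apply hp
      rw [← slice_apply, hg'.eq_ev_stem hJ hζ, h0, ← cx_zero]
      simp [ev]
    refine (quad_pow_unique hζ hg'.holStem hW h1 (h.cofactor_ne_zero him) fun z hz => ?_).1
    rw [← h.eq' hz, stem_congr_of_eqOn he hz, stem_sphFactor_pow_mul, quad_eq]
  · rintro rfl
    refine ⟨ofStem fun z => linProd L z * stem g z, hW.sliceRegularOn, ?_, fun q hq => ?_⟩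
    · by_contra! h0
      have h1 : ∀ J ∈ imagUnits, ev J (linProd L ζ * stem g ζ) = 0 := fun J hJ => by
        rw [← ofStem_slice hW hJ, slice_apply]
        exact h0 _ ⟨J, hJ, rfl⟩
      exact h.cofactor_ne_zero him
        (ev_inj (h1 _ unitI_mem) (h1 _ (neg_mem_imagUnits unitI_mem)) unitI_mem)
    · obtain ⟨J, hJ, hq'⟩ := exists_slice q
      have hz := param_mem_ball hq
      rw [hq', hf.eq_ev_stem hJ hz, h.eq' hz, ev_mul_coe J hJ, ofStem_slice hW hJ,
        sphFactor_slice hJ, slice_pow hJ, slice_apply]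

/-- The condition in the definition of the isolated multiplicity at a nonreal point describes
the normal forms of the function. -/
lemma isNormalForm_iff (hf : SliceRegularOn f (ball 0 r)) (hζ : ζ ∈ ball (0 : ℂ) r)
    (hpos : 0 < ζ.im) {J : ℍ[ℝ]} (hJ : J ∈ imagUnits) :
    IsNormalForm f r ζ (pt J ζ.re ζ.im :: L) m g ↔
      (∀ p ∈ L, p ∈ sphereOf (pt J ζ.re ζ.im)) ∧
      List.IsChain (fun p p' => star p' ≠ p) (pt J ζ.re ζ.im :: L) ∧
      SliceRegularOn g (ball 0 r) ∧ (∀ p ∈ sphereOf (pt J ζ.re ζ.im), g p ≠ 0) ∧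
      ∀ q ∈ ball (0 : ℍ[ℝ]) r, f q = starFactors (pt J ζ.re ζ.im :: L)
        (fun p => sphFactor (pt J ζ.re ζ.im).re ‖(pt J ζ.re ζ.im).im‖ p ^ m * g p) q := by
  rw [sphereOf, pt_re hJ, norm_pt_im hJ, abs_of_pos hpos]
  have hst : ∀ z, stem (starFactors (pt J ζ.re ζ.im :: L)
      (fun p => sphFactor ζ.re ζ.im p ^ m * g p)) z =
      linProd (pt J ζ.re ζ.im :: L) z * (((quad ζ z ^ m : ℂ) : ℍ[ℂ]) * stem g z) := fun z => by
    rw [stem_starFactors, stem_sphFactor_pow_mul, quad_eq]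
  constructor
  · intro h
    refine ⟨fun p hp => h.mem p (List.mem_cons_of_mem _ hp), h.chain, h.regular, ?_, fun q hq => ?_⟩
    · rintro p ⟨K, hK, rfl⟩
      rw [← slice_apply, h.regular.eq_ev_stem hK hζ]
      exact h.ne_zero K hK
    · obtain ⟨K, hK, hq'⟩ := exists_slice q
      have hz := param_mem_ball hq
      rw [hq', hf.eq_ev_stem hK hz, slice_apply, starFactors_cons_pt _ _ _ hK, hst, h.eq _ hz]
  · rintro ⟨h1, h2, h3, h4, h5⟩
    refine ⟨h3, ?_, h2, fun K hK => ?_, fun z hz => ?_⟩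
    · intro p hp
      rcases List.mem_cons.1 hp with rfl | hp
      · exact ⟨J, hJ, rfl⟩
      · exact h1 p hp
    · rw [← h3.eq_ev_stem hK hζ, slice_apply]
      exact h4 _ ⟨K, hK, rfl⟩
    · rw [stem_congr_of_eqOn h5 hz, hst]

lemma pt_im_ne_zero (hpos : 0 < ζ.im) {J : ℍ[ℝ]} (hJ : J ∈ imagUnits) :
    (pt J ζ.re ζ.im).im ≠ 0 := by
  rw [← norm_ne_zero_iff, norm_pt_im hJ, abs_of_pos hpos]
  exact hpos.ne'

lemma isolatedMult_eq_sSup (hf : SliceRegularOn f (ball 0 r)) (hζ : ζ ∈ ball (0 : ℂ) r)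
    (hpos : 0 < ζ.im) {J : ℍ[ℝ]} (hJ : J ∈ imagUnits) :
    isolatedMult f (ball 0 r) (pt J ζ.re ζ.im) =
      sSup {n : ℕ | ∃ L m g, (pt J ζ.re ζ.im :: L).length = n ∧
        IsNormalForm f r ζ (pt J ζ.re ζ.im :: L) m g} := by
  rw [isolatedMult, if_neg (pt_im_ne_zero hpos hJ)]
  simp only [isNormalForm_iff hf hζ hpos hJ]

lemma isolatedMult_eq_zero (h : IsNormalForm f r ζ L m g)
    (hf : SliceRegularOn f (ball 0 r)) (hζ : ζ ∈ ball (0 : ℂ) r)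
    (hpos : 0 < ζ.im) {b : ℍ[ℝ]} (hb : b ∈ sphereAt ζ.re ζ.im) (hL : L.head? ≠ some b) :
    isolatedMult f (ball 0 r) b = 0 := by
  obtain ⟨J, hJ, rfl⟩ := hb
  rw [isolatedMult_eq_sSup hf hζ hpos hJ]
  -- No normal form starts with `b`, and the supremum of the empty set of naturals is `0`, as the
  -- definition of the multiplicity intends.
  refine (congrArg sSup (?_ : _ = ∅)).trans csSup_empty
  ext n
  simp only [Set.mem_ofPred_eq, Set.mem_empty_iff_false, iff_false]
  rintro ⟨L', m', g', -, h'⟩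
  exact hL (h.head_unique hζ hpos.ne' h')

/-- All normal forms share `m` and the order `L.length + 2 * m`, hence the length of the list; again
the supremum is over a singleton. -/
lemma isolatedMult_head {c : ℍ[ℝ]} (h : IsNormalForm f r ζ (c :: L) m g)
    (hf : SliceRegularOn f (ball 0 r)) (hζ : ζ ∈ ball (0 : ℂ) r) (hpos : 0 < ζ.im) :
    isolatedMult f (ball 0 r) c = (c :: L).length := by
  obtain ⟨J, hJ, rfl⟩ := h.mem c (by simp)
  rw [isolatedMult_eq_sSup hf hζ hpos hJ]
  apply sSup_eq_of_eq_singleton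
  ext n
  simp only [Set.mem_ofPred_eq, Set.mem_singleton_iff]
  constructor
  · rintro ⟨L', m', g', rfl, h'⟩
    have h1 := (h.unique hζ hpos.ne' h').1
    have h2 := (h.analyticOrderAt_eq hf hζ hpos.ne').symm.trans
      (h'.analyticOrderAt_eq hf hζ hpos.ne')
    have h3 := Nat.cast_injective h2
    omega
  · rintro rfl
    exact ⟨L, m, g, rfl, h⟩

/-- On a sphere the isolated multiplicity is concentrated in one point, and the multiplicities add
up to the order of the norm form. -/
theorem SliceRegularOn.exists_isolatedMult (hf : SliceRegularOn f (ball 0 r))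
    (hζ : ζ ∈ ball (0 : ℂ) r) (hpos : 0 < ζ.im) (hn : analyticOrderAt (stemNorm f) ζ ≠ ⊤) :
    ∃ c ∈ sphereAt ζ.re ζ.im,
      (∀ b ∈ sphereAt ζ.re ζ.im, b ≠ c → isolatedMult f (ball 0 r) b = 0) ∧
      isolatedMult f (ball 0 r) c + 2 * sphericalMult f (ball 0 r) ζ.re ζ.im =
        analyticOrderNatAt (stemNorm f) ζ := by
  obtain ⟨n, hn⟩ := ENat.ne_top_iff_exists.1 hn
  obtain ⟨L, m, g, h⟩ := SliceRegularOn.exists_isNormalForm hζ hpos.ne' n f hf hn.symm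
  rw [analyticOrderNatAt, h.analyticOrderAt_eq hf hζ hpos.ne', ENat.toNat_natCast,
    h.sphericalMult_eq hf hζ hpos.ne']
  cases L with
  | nil =>
    refine ⟨pt unitI ζ.re ζ.im, ⟨_, unitI_mem, rfl⟩, fun b hb _ => ?_, ?_⟩
    · exact isolatedMult_eq_zero h hf hζ hpos hb (by simp)
    · rw [isolatedMult_eq_zero h hf hζ hpos ⟨_, unitI_mem, rfl⟩ (by simp), List.length_nil]
  | cons c L =>
    refine ⟨c, h.mem c (by simp), fun b hb hbc => ?_, ?_⟩
    · exact isolatedMult_eq_zero h hf hζ hpos hb (by simpa using hbc.symm)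
    · rw [isolatedMult_head h hf hζ hpos]

/-! ### Multiplicities at real points -/

lemma stemNorm_real (f : ℍ[ℝ] → ℍ[ℝ]) (a : ℝ) :
    stemNorm f a = ((‖f (a : ℍ[ℝ])‖ ^ 2 : ℝ) : ℂ) ∧ stem f a = cx (f (a : ℍ[ℝ])) 0 := by
  have h0 := beta_neg f a 0
  rw [neg_zero, eq_neg_iff_add_eq_zero, ← two_smul ℝ] at h0
  have h1 := (smul_eq_zero.1 h0).resolve_left two_ne_zero
  have h2 := alpha_add_beta f a 0
  rw [h1, mul_zero, add_zero, pt_zero_right] at h2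
  have h3 : stem f a = cx (f (a : ℍ[ℝ])) 0 := by
    rw [stem, Complex.ofReal_re, Complex.ofReal_im, h1, h2]
  refine ⟨?_, h3⟩
  rw [stemNorm, h3, normSq_eq, rePart_cx, imPart_cx, sq, ← Quaternion.normSq_eq_norm_mul_self]
  apply Complex.ext <;> simp

lemma analyticOrderAt_of_real_factor (hf : SliceRegularOn f (ball 0 r))
    (hg : SliceRegularOn g (ball 0 r)) {a : ℝ} (ha : (a : ℂ) ∈ ball (0 : ℂ) r) {n : ℕ}
    (hga : g a ≠ 0)
    (h : ∀ z ∈ ball (0 : ℂ) r, stem f z = (((z - a) ^ n : ℂ) : ℍ[ℂ]) * stem g z) :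
    analyticOrderAt (stemNorm f) a = ((2 * n : ℕ) : ℕ∞) := by
  rw [(hf.analyticAt_stemNorm ha).analyticOrderAt_eq_natCast]
  refine ⟨stemNorm g, hg.analyticAt_stemNorm ha, ?_, ?_⟩
  · rw [(stemNorm_real g a).1, Complex.ofReal_ne_zero]
    exact pow_ne_zero _ (norm_ne_zero_iff.2 hga)
  · filter_upwards [isOpen_ball.mem_nhds ha] with z hz
    rw [stemNorm, h z hz, map_mul, Quaternion.normSq_coe, ← pow_mul, mul_comm n 2]
    rfl

lemma SliceRegularOn.exists_real_factor {a : ℝ} (ha : (a : ℂ) ∈ ball (0 : ℂ) r) (n : ℕ)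
    (f : ℍ[ℝ] → ℍ[ℝ]) (hf : SliceRegularOn f (ball 0 r))
    (hn : analyticOrderAt (stemNorm f) a = n) :
    ∃ (k : ℕ) (g : ℍ[ℝ] → ℍ[ℝ]), SliceRegularOn g (ball 0 r) ∧ g a ≠ 0 ∧
      ∀ z, stem f z = (((z - a) ^ k : ℂ) : ℍ[ℂ]) * stem g z := by
  induction n using Nat.strong_induction_on generalizing f with
  | _ n ih =>
  by_cases h0 : f a = 0
  · have h1 : stem f a = 0 := by rw [(stemNorm_real f a).2, h0, cx_zero]
    obtain ⟨f', hf', h2⟩ := hf.exists_sub_real_mul ha h1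
    have h3 : stemNorm f = (fun z : ℂ => (z - a) ^ 2) * stemNorm f' := by
      ext z
      rw [stemNorm, h2, map_mul, Quaternion.normSq_coe]; rfl
    rw [h3] at hn
    obtain ⟨k, hk, h4⟩ := exists_lt_of_analyticOrderAt_mul (by fun_prop)
      (hf'.analyticAt_stemNorm ha) (by simp) hn
    obtain ⟨k', g, hg, hga, h5⟩ := ih k hk f' hf' h4
    refine ⟨k' + 1, g, hg, hga, fun z => ?_⟩
    rw [h2, h5, pow_succ', Quaternion.coe_mul, mul_assoc]
  · exact ⟨0, f, hf, h0, fun z => by simp⟩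

/-- At a real point the isolated multiplicity is half the order of the norm form. -/
theorem SliceRegularOn.two_mul_isolatedMult_real (hf : SliceRegularOn f (ball 0 r)) {a : ℝ}
    (ha : (a : ℂ) ∈ ball (0 : ℂ) r) (hn : analyticOrderAt (stemNorm f) a ≠ ⊤) :
    2 * isolatedMult f (ball 0 r) a = analyticOrderNatAt (stemNorm f) a := by
  obtain ⟨n, hn⟩ := ENat.ne_top_iff_exists.1 hn
  obtain ⟨k, g, hg, hga, h⟩ := SliceRegularOn.exists_real_factor ha n f hf hn.symm
  have ho := analyticOrderAt_of_real_factor hf hg ha hga fun z _ => h z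
  rw [analyticOrderNatAt, ho, ENat.toNat_natCast, isolatedMult, if_pos (by simp)]
  congr 1
  apply sSup_eq_of_eq_singleton
  ext l
  simp only [Set.mem_ofPred_eq, Set.mem_singleton_iff]
  constructor
  · rintro ⟨g', hg', hga', he⟩
    have ho' := analyticOrderAt_of_real_factor hf hg' ha hga' fun z hz => by
      rw [stem_congr_of_eqOn he hz, stem_sub_real_pow_mul]
    have := Nat.cast_injective (ho'.symm.trans ho)
    omega
  · rintro rfl
    refine ⟨g, hg, hga, fun q hq => ?_⟩
    obtain ⟨J, hJ, hq'⟩ := exists_slice q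
    have hz := param_mem_ball hq
    have e : slice J (param q) - (a : ℍ[ℝ]) = slice J (param q - a) := by
      rw [map_sub, slice_apply J (a : ℂ)]; simp [pt_zero_right]
    rw [hq', hf.eq_ev_stem hJ hz, h, ev_mul_coe J hJ, ← hg.eq_ev_stem hJ hz, e, slice_pow hJ,
      slice_apply J (_ ^ _)]

/-! ### Counting zeros with the norm form -/

open MeasureTheory

lemma SliceRegularOn.analyticOrderAt_ne_top (hf : SliceRegularOn f (ball 0 r)) (hf0 : f 0 ≠ 0)
    (hζ : ζ ∈ ball (0 : ℂ) r) : analyticOrderAt (stemNorm f) ζ ≠ ⊤ := by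
  have ha : AnalyticOnNhd ℂ (stemNorm f) (ball 0 r) := fun z hz => hf.analyticAt_stemNorm hz
  have h0 : (0 : ℂ) ∈ ball (0 : ℂ) r := mem_ball_self (pos_of_mem_ball hζ)
  refine ha.analyticOrderAt_ne_top_of_isPreconnected (convex_ball 0 r).isPreconnected h0 hζ ?_
  have h1 := (stemNorm_real f 0).1
  rw [Complex.ofReal_zero, Quaternion.coe_zero] at h1
  rw [(ha 0 h0).analyticOrderAt_eq_zero.2 (by
    rw [h1, Complex.ofReal_ne_zero]; exact pow_ne_zero _ (norm_ne_zero_iff.2 hf0))]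
  exact ENat.zero_ne_top

lemma SliceRegularOn.analyticOrderNatAt_conj (hf : SliceRegularOn f (ball 0 r))
    (hζ : ζ ∈ ball (0 : ℂ) r) (him : ζ.im ≠ 0) (hn : analyticOrderAt (stemNorm f) ζ ≠ ⊤) :
    analyticOrderNatAt (stemNorm f) (starRingEnd ℂ ζ) = analyticOrderNatAt (stemNorm f) ζ := by
  obtain ⟨n, hn⟩ := ENat.ne_top_iff_exists.1 hn
  obtain ⟨L, m, g, h⟩ := SliceRegularOn.exists_isNormalForm hζ him n f hf hn.symm
  rw [analyticOrderNatAt, analyticOrderNatAt, h.analyticOrderAt_eq hf hζ him,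
    h.analyticOrderAt_conj_eq hf hζ him]

lemma param_of_mem_sphereAt (hnn : 0 ≤ ζ.im) {q : ℍ[ℝ]} (hq : q ∈ sphereAt ζ.re ζ.im) :
    param q = ζ := by
  obtain ⟨J, hJ, rfl⟩ := hq
  rw [param, pt_re hJ, norm_pt_im hJ, abs_of_nonneg hnn]

lemma mem_sphereAt_param (q : ℍ[ℝ]) : q ∈ sphereAt (param q).re (param q).im := by
  obtain ⟨J, hJ, h⟩ := exists_pt q
  exact ⟨J, hJ, h⟩

/-- The conditions on `ζ` stand inside the existential so that `choose` gives a total map `c` from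
parameters to points; outside the closed upper half of the disc its value is irrelevant. -/
lemma SliceRegularOn.exists_isolatedMult_of_nonneg (hf : SliceRegularOn f (ball 0 r))
    (hf0 : f 0 ≠ 0) (ζ : ℂ) :
    ∃ c : ℍ[ℝ], ζ ∈ ball (0 : ℂ) r → 0 ≤ ζ.im → c ∈ sphereAt ζ.re ζ.im ∧
      (∀ b ∈ sphereAt ζ.re ζ.im, b ≠ c → isolatedMult f (ball 0 r) b = 0) ∧
      (ζ.im = 0 → 2 * isolatedMult f (ball 0 r) c = analyticOrderNatAt (stemNorm f) ζ) ∧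
      (0 < ζ.im → isolatedMult f (ball 0 r) c + 2 * sphericalMult f (ball 0 r) ζ.re ζ.im =
        analyticOrderNatAt (stemNorm f) ζ) := by
  by_cases hζ : ζ ∈ ball (0 : ℂ) r ∧ 0 ≤ ζ.im
  swap
  · exact ⟨0, fun h1 h2 => absurd ⟨h1, h2⟩ hζ⟩
  obtain ⟨hζ, hnn⟩ := hζ
  have hn := hf.analyticOrderAt_ne_top hf0 hζ
  rcases hnn.eq_or_lt with h0 | hpos
  · have e : ζ = (ζ.re : ℂ) := by apply Complex.ext <;> simp [h0.symm]
    refine ⟨(ζ.re : ℍ[ℝ]), fun _ _ => ⟨?_, ?_, fun _ => ?_, fun h => absurd h0 h.ne⟩⟩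
    · exact ⟨unitI, unitI_mem, by rw [← h0, pt_zero_right]⟩
    · rintro b ⟨J, hJ, rfl⟩ hb
      rw [← h0, pt_zero_right] at hb
      exact absurd rfl hb
    · rw [e] at hζ hn
      rw [hf.two_mul_isolatedMult_real hζ hn, ← e]
  · obtain ⟨c, h1, h2, h3⟩ := hf.exists_isolatedMult hζ hpos hn
    exact ⟨c, fun _ _ => ⟨h1, h2, fun h => absurd h hpos.ne', fun _ => h3⟩⟩

/-- Twice the number of zeros is the number of zeros of the norm form of the stem function. -/
lemma SliceRegularOn.two_mul_zeroCount (hf : SliceRegularOn f (ball 0 R)) (hf0 : f 0 ≠ 0)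
    {Z : Finset ℂ} (hZ : ∀ z ∈ ball (0 : ℂ) R, analyticOrderNatAt (stemNorm f) z ≠ 0 → z ∈ Z)
    {t : ℝ} (htR : t ≤ R) :
    2 * zeroCount f R t = ∑ u ∈ Z with ‖u‖ < t, analyticOrderNatAt (stemNorm f) u := by
  choose c hc using hf.exists_isolatedMult_of_nonneg hf0
  set ord := fun u => analyticOrderNatAt (stemNorm f) u with hord
  have hball : ∀ {u : ℂ}, ‖u‖ < t → u ∈ ball (0 : ℂ) R := fun h => by
    simpa using h.trans_le htR
  -- Zeros of the norm form on the real axis, above it and below it. Those in `A` have order twice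
  -- the isolated multiplicity. Each sphere is represented by one point of `B`, and the conjugates
  -- in `C` supply the second copy.
  set A : Finset ℂ := {u ∈ Z | ‖u‖ < t ∧ u.im = 0}
  set B : Finset ℂ := {u ∈ Z | ‖u‖ < t ∧ 0 < u.im}
  set C : Finset ℂ := {u ∈ Z | ‖u‖ < t ∧ u.im < 0}
  have hAB : Disjoint A B := Finset.disjoint_left.2 fun u h1 h2 => by
    simp only [A, B, Finset.mem_filter] at h1 h2
    exact absurd h1.2.2 h2.2.2.ne'
  have hmem : ∀ u ∈ A ∪ B, u ∈ ball (0 : ℂ) R ∧ 0 ≤ u.im ∧ ‖u‖ < t := by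
    intro u hu
    simp only [A, B, Finset.mem_union, Finset.mem_filter] at hu
    rcases hu with ⟨-, h1, h2⟩ | ⟨-, h1, h2⟩
    · exact ⟨hball h1, h2.ge, h1⟩
    · exact ⟨hball h1, h2.le, h1⟩
  have hpar : ∀ u ∈ A ∪ B, param (c u) = u := fun u hu =>
    param_of_mem_sphereAt (hmem u hu).2.1 (hc u (hmem u hu).1 (hmem u hu).2.1).1
  have s1 : ∑ᶠ a ∈ ball (0 : ℍ[ℝ]) t, isolatedMult f (ball 0 R) a =
      ∑ u ∈ A ∪ B, isolatedMult f (ball 0 R) (c u) := by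
    classical
    rw [← Finset.sum_image (s := A ∪ B) (g := c) (f := fun a => isolatedMult f (ball 0 R) a)
      -- The map `c` is injective here because `param` recovers `u` from `c u`.
      fun u hu v hv huv => by rw [← hpar u hu, ← hpar v hv, huv]]
    apply finsum_mem_eq_sum_of_inter_support_eq
    ext q
    simp only [Set.mem_inter_iff, Function.mem_support, and_congr_left_iff, Finset.coe_image,
      Set.mem_image, Finset.mem_coe]
    intro hq
    constructor
    · intro hqt
      have hpt : ‖param q‖ < t := by rw [norm_param]; simpa using hqt
      have h0 : 0 ≤ (param q).im := norm_nonneg _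
      obtain ⟨-, h2, h3, h4⟩ := hc (param q) (hball hpt) h0
      have hqc : q = c (param q) := by
        by_contra hne
        exact hq (h2 q (mem_sphereAt_param q) hne)
      refine ⟨param q, ?_, hqc.symm⟩
      rw [← hqc] at h3 h4
      have hZq : param q ∈ Z := by
        refine hZ _ (hball hpt) ?_
        rcases h0.eq_or_lt with h | h
        · have := h3 h.symm; omega
        · have := h4 h; omega
      rw [Finset.mem_union, Finset.mem_filter, Finset.mem_filter]
      rcases h0.eq_or_lt with h | h
      · exact Or.inl ⟨hZq, hpt, h.symm⟩
      · exact Or.inr ⟨hZq, hpt, h⟩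
    · rintro ⟨u, hu, rfl⟩
      rw [mem_ball_zero_iff, ← norm_param, hpar u hu]
      exact (hmem u hu).2.2
  have s2 : ∑ᶠ p ∈ {p : ℝ × ℝ | 0 < p.2 ∧ pt unitI p.1 p.2 ∈ ball (0 : ℍ[ℝ]) t},
      sphericalMult f (ball 0 R) p.1 p.2 = ∑ u ∈ B, sphericalMult f (ball 0 R) u.re u.im := by
    have e : ∑ u ∈ B, sphericalMult f (ball 0 R) u.re u.im =
        ∑ p ∈ B.map Complex.equivRealProd.toEmbedding, sphericalMult f (ball 0 R) p.1 p.2 := by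
      rw [Finset.sum_map]; rfl
    rw [e]
    apply finsum_mem_eq_sum_of_inter_support_eq
    ext ⟨x, y⟩
    simp only [Set.mem_inter_iff, Function.mem_support, and_congr_left_iff, Finset.coe_map,
      Set.mem_image, Finset.mem_coe, Set.mem_ofPred_eq, pt_mem_ball unitI_mem]
    intro hs
    constructor
    · rintro ⟨hy, hb⟩
      have hb' : ‖(⟨x, y⟩ : ℂ)‖ < t := by simpa using hb
      refine ⟨⟨x, y⟩, ?_, rfl⟩
      obtain ⟨-, -, -, h4⟩ := hc ⟨x, y⟩ (hball hb') hy.le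
      have h5 := h4 hy
      rw [Finset.mem_filter]
      exact ⟨hZ _ (hball hb') (by simp only at h5; omega), hb', hy⟩
    · rintro ⟨u, hu, huv⟩
      have hu' : u = ⟨x, y⟩ := Complex.equivRealProd.injective huv
      subst hu'
      rw [Finset.mem_filter] at hu
      exact ⟨hu.2.2, by simpa using hu.2.1⟩
  have s3 : ∑ u ∈ Z with ‖u‖ < t, ord u = ∑ u ∈ A, ord u + ∑ u ∈ B, ord u + ∑ u ∈ C, ord u := by
    have hABC : Disjoint (A ∪ B) C := Finset.disjoint_left.2 fun u h1 h2 => by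
      have := (hmem u h1).2.1
      simp only [C, Finset.mem_filter] at h2
      linarith
    rw [← Finset.sum_union hAB, ← Finset.sum_union hABC]
    refine Finset.sum_congr ?_ fun _ _ => rfl
    ext u
    simp only [A, B, C, Finset.mem_union, Finset.mem_filter]
    rcases lt_trichotomy u.im 0 with h | h | h
    · simp [h, h.ne, not_lt.2 h.le]
    · simp [h]
    · simp [h, h.ne', not_lt.2 h.le]
  have s4 : ∑ u ∈ C, ord u = ∑ u ∈ B, ord u := by
    have hconj : ∀ u : ℂ, ‖u‖ < t → u.im ≠ 0 → ord (starRingEnd ℂ u) = ord u := fun u h h' =>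
      hf.analyticOrderNatAt_conj (hball h) h' (hf.analyticOrderAt_ne_top hf0 (hball h))
    -- `Z` is not assumed closed under conjugation, but it contains all points of nonzero order in
    -- the disc, so conjugation matches the nonzero terms.
    refine Finset.sum_bij_ne_zero (fun u _ _ => starRingEnd ℂ u) ?_ ?_ ?_ ?_
    · intro u hu h0
      simp only [C, B, Finset.mem_filter] at hu ⊢
      have hn : ‖starRingEnd ℂ u‖ < t := by simpa using hu.2.1
      refine ⟨hZ _ (hball hn) ?_, hn, by simpa using hu.2.2⟩
      have := hconj u hu.2.1 hu.2.2.ne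
      simp only [hord] at this h0
      rwa [this]
    · intro u _ _ v _ _ h
      exact (starRingEnd ℂ).injective h
    · intro u hu h0
      simp only [C, B, Finset.mem_filter] at hu ⊢
      have hn : ‖starRingEnd ℂ u‖ < t := by simpa using hu.2.1
      have := hconj u hu.2.1 hu.2.2.ne'
      have h1 : ord (starRingEnd ℂ u) ≠ 0 := by rwa [this]
      exact ⟨starRingEnd ℂ u, ⟨hZ _ (hball hn) h1, hn, by simpa using hu.2.2⟩, h1,
        Complex.conj_conj u⟩
    · intro u hu _
      simp only [C, Finset.mem_filter] at hu
      exact (hconj u hu.2.1 hu.2.2.ne).symm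
  have s5 : ∑ u ∈ A, ord u = 2 * ∑ u ∈ A, isolatedMult f (ball 0 R) (c u) := by
    rw [Finset.mul_sum]
    refine Finset.sum_congr rfl fun u hu => ?_
    have h1 := hmem u (Finset.mem_union_left _ hu)
    rw [Finset.mem_filter] at hu
    exact ((hc u h1.1 h1.2.1).2.2.1 hu.2.2).symm
  have s6 : ∑ u ∈ B, ord u = ∑ u ∈ B, isolatedMult f (ball 0 R) (c u) +
      2 * ∑ u ∈ B, sphericalMult f (ball 0 R) u.re u.im := by
    rw [Finset.mul_sum, ← Finset.sum_add_distrib]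
    refine Finset.sum_congr rfl fun u hu => ?_
    have h1 := hmem u (Finset.mem_union_right _ hu)
    rw [Finset.mem_filter] at hu
    exact ((hc u h1.1 h1.2.1).2.2.2 hu.2.2).symm
  rw [zeroCount, s1, s2, s3, s4, s5, s6, Finset.sum_union hAB]
  ring

/-! ### Jensen's formula for the norm form -/

/-- The contribution of one zero of modulus `a`; the integrand vanishes on `(0, a)`, so `1 / t`
causes no singularity at `0`. -/
lemma integral_step_div {a : ℝ} (ha : 0 < a) (haR : a < R) :
    IntervalIntegrable (fun t => (if a < t then (1 : ℝ) else 0) / t) volume 0 R ∧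
    ∫ t in (0 : ℝ)..R, (if a < t then (1 : ℝ) else 0) / t = Real.log (R / a) := by
  have e1 : Set.EqOn (fun _ => (0 : ℝ)) (fun t => (if a < t then (1 : ℝ) else 0) / t)
      (Set.uIoo 0 a) := by
    intro t ht
    rw [Set.uIoo_of_le ha.le] at ht
    simp [not_lt.2 ht.2.le]
  have e2 : Set.EqOn (fun t : ℝ => t⁻¹) (fun t => (if a < t then (1 : ℝ) else 0) / t)
      (Set.uIoo a R) := by
    intro t ht
    rw [Set.uIoo_of_le haR.le] at ht
    simp [ht.1]
  have i1 : IntervalIntegrable (fun t => (if a < t then (1 : ℝ) else 0) / t) volume 0 a :=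
    (intervalIntegrable_const (c := (0 : ℝ))).congr_uIoo e1
  have i2 : IntervalIntegrable (fun t => (if a < t then (1 : ℝ) else 0) / t) volume a R := by
    refine IntervalIntegrable.congr_uIoo ?_ e2
    exact intervalIntegral.intervalIntegrable_inv (fun x hx => (by
      rw [Set.uIcc_of_le haR.le] at hx; exact (ha.trans_le hx.1).ne')) continuousOn_id
  refine ⟨i1.trans i2, ?_⟩
  rw [← intervalIntegral.integral_add_adjacent_intervals i1 i2,
    ← intervalIntegral.integral_congr_uIoo e1, ← intervalIntegral.integral_congr_uIoo e2,
    integral_inv_of_pos ha (ha.trans haR)]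
  simp

/-- Jensen's formula for a slice regular function in terms of the norm form. -/
theorem SliceRegularOn.integral_zeroCount (hR : 0 < R) (hRr : R < r)
    (hf : SliceRegularOn f (ball 0 r)) (hf0 : f 0 ≠ 0) :
    IntervalIntegrable (fun t => (zeroCount f R t : ℝ) / t) volume 0 R ∧
    ∫ t in (0 : ℝ)..R, (zeroCount f R t : ℝ) / t =
      1 / 2 * (Real.circleAverage (fun z => Real.log ‖stemNorm f z‖) 0 R -
        Real.log ‖stemNorm f 0‖) := by
  have hsub : closedBall (0 : ℂ) |R| ⊆ ball 0 r := by
    rw [abs_of_pos hR]; exact closedBall_subset_ball hRr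
  have ha : AnalyticOnNhd ℂ (stemNorm f) (closedBall 0 |R|) := fun z hz =>
    hf.analyticAt_stemNorm (hsub hz)
  have hN0 : stemNorm f 0 ≠ 0 := by
    have h1 := (stemNorm_real f 0).1
    rw [Complex.ofReal_zero, Quaternion.coe_zero] at h1
    rw [h1, Complex.ofReal_ne_zero]; exact pow_ne_zero _ (norm_ne_zero_iff.2 hf0)
  -- Multiplicities in `zeroCount` refer to the ball of radius `R`; the larger radius `r` makes the
  -- norm form analytic on the closed disc.
  have hfR : SliceRegularOn f (ball 0 R) :=
    ⟨hf.1.mono (ball_subset_ball hRr.le), fun I hI x y h => hf.2 I hI x y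
      (ball_subset_ball hRr.le h)⟩
  set D := MeromorphicOn.divisor (stemNorm f) (closedBall 0 |R|) with hD
  have hDu : ∀ u ∈ closedBall (0 : ℂ) |R|, D u = (analyticOrderNatAt (stemNorm f) u : ℤ) := by
    intro u hu
    rw [hD, MeromorphicOn.AnalyticOnNhd.divisor_apply ha hu]
    obtain ⟨n, hn⟩ := ENat.ne_top_iff_exists.1 (hf.analyticOrderAt_ne_top hf0 (hsub hu))
    rw [analyticOrderNatAt, ← hn]
    simp
  have hfin := D.finiteSupport (isCompact_closedBall 0 |R|)
  -- Zeros with `|u| = R` may be dropped: they are never counted for `t ≤ R`, and their term in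
  -- Jensen's formula is a multiple of `log 1`.
  set Z : Finset ℂ := {u ∈ hfin.toFinset | ‖u‖ < R}
  have hZ : ∀ z ∈ ball (0 : ℂ) R, analyticOrderNatAt (stemNorm f) z ≠ 0 → z ∈ Z := by
    intro z hz h
    have hz' : z ∈ closedBall (0 : ℂ) |R| := by
      rw [abs_of_pos hR]; exact ball_subset_closedBall hz
    rw [Finset.mem_filter, Set.Finite.mem_toFinset, Function.mem_support, hDu z hz']
    exact ⟨by exact_mod_cast h, by simpa using hz⟩
  have hZR : ∀ u ∈ Z, ‖u‖ < R := fun u hu => (Finset.mem_filter.1 hu).2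
  have hZc : ∀ u ∈ Z, u ∈ closedBall (0 : ℂ) |R| := fun u hu => by
    rw [abs_of_pos hR, mem_closedBall_zero_iff]; exact (hZR u hu).le
  have hZ0 : ∀ u ∈ Z, 0 < ‖u‖ := by
    intro u hu
    rw [norm_pos_iff]
    rintro rfl
    have h1 := (Finset.mem_filter.1 hu).1
    rw [Set.Finite.mem_toFinset, Function.mem_support, hDu 0 (hZc 0 hu)] at h1
    apply h1
    rw [analyticOrderNatAt, (ha 0 (hZc 0 hu)).analyticOrderAt_eq_zero.2 hN0]
    rfl
  have hcount : Set.EqOn (fun t => ∑ u ∈ Z, (1 / 2 * (analyticOrderNatAt (stemNorm f) u : ℝ)) *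
      ((if ‖u‖ < t then (1 : ℝ) else 0) / t)) (fun t => (zeroCount f R t : ℝ) / t)
      (Set.uIoo 0 R) := by
    intro t ht
    rw [Set.uIoo_of_le hR.le] at ht
    have h1 := congrArg (Nat.cast (R := ℝ)) (hfR.two_mul_zeroCount hf0 hZ ht.2.le)
    push_cast at h1
    have h2 : (zeroCount f R t : ℝ) = 1 / 2 *
        ∑ u ∈ Z with ‖u‖ < t, (analyticOrderNatAt (stemNorm f) u : ℝ) := by linarith
    simp only [h2]
    rw [Finset.sum_filter (fun u : ℂ => ‖u‖ < t), Finset.mul_sum, Finset.sum_div]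
    refine Finset.sum_congr rfl fun u _ => ?_
    split_ifs <;> ring
  have hi : ∀ u ∈ Z, IntervalIntegrable (fun t => (1 / 2 *
      (analyticOrderNatAt (stemNorm f) u : ℝ)) * ((if ‖u‖ < t then (1 : ℝ) else 0) / t))
      volume 0 R := fun u hu => (integral_step_div (hZ0 u hu) (hZR u hu)).1.const_mul _
  refine ⟨IntervalIntegrable.congr_uIoo ?_ hcount, ?_⟩
  · have := IntervalIntegrable.sum Z hi
    simpa only [Finset.sum_fn] using this
  rw [← intervalIntegral.integral_congr_uIoo hcount, intervalIntegral.integral_finsetSum hi,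
    ha.circleAverage_log_norm hR.ne' hN0, add_sub_cancel_right,
    finsum_eq_sum_of_support_subset (s := Z), Finset.mul_sum]
  · refine Finset.sum_congr rfl fun u hu => ?_
    rw [intervalIntegral.integral_const_mul, (integral_step_div (hZ0 u hu) (hZR u hu)).2, ← hD,
      hDu u (hZc u hu), zero_sub, norm_neg, div_eq_mul_inv R, Int.cast_natCast, mul_assoc]
  · intro u hu
    rw [Function.mem_support] at hu
    have hDne : D u ≠ 0 := by
      intro h; apply hu; rw [← hD, h]; simp
    have huc : u ∈ closedBall (0 : ℂ) |R| := D.supportWithinDomain hDne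
    rw [Finset.mem_coe, Finset.mem_filter, Set.Finite.mem_toFinset]
    refine ⟨hDne, lt_of_le_of_ne ?_ fun h => hu ?_⟩
    · simpa [abs_of_pos hR] using huc
    · rw [zero_sub, norm_neg, h, mul_inv_cancel₀ hR.ne', Real.log_one, mul_zero]

/-! ### Intrinsic factors and behaviour on the boundary -/

lemma eq_coe_of_commute {q : ℍ[ℝ]} (hq : ∀ J ∈ imagUnits, q * J = J * q) : q = (q.re : ℍ[ℝ]) := by
  have h1 := hq unitI unitI_mem
  have h2 := hq (eb 2) (mem_imagUnits_of_sq (by simp) (by simp))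
  have e1 := congrArg QuaternionAlgebra.imJ h1
  have e2 := congrArg QuaternionAlgebra.imK h1
  have e3 := congrArg QuaternionAlgebra.imK h2
  simp [show unitI.re = 0 from rfl, show unitI.imI = 1 from rfl, show unitI.imJ = 0 from rfl,
    show unitI.imK = 0 from rfl] at e1 e2 e3
  ext <;> simp <;> linarith

lemma pt_mul_comm (J : ℍ[ℝ]) (x y : ℝ) : pt J x y * J = J * pt J x y := by
  rw [pt, add_mul, mul_add, Quaternion.coe_commutes, mul_assoc, Quaternion.coe_commutes]

/-- The stem function of an intrinsic function is complex valued. -/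
lemma IntrinsicOn.stem_eq (hg : IntrinsicOn g (ball 0 r)) (hζ : ζ ∈ ball (0 : ℂ) r) :
    stem g ζ = ((stem g ζ).re : ℍ[ℂ]) := by
  have hcomm : ∀ J ∈ imagUnits, ev J (stem g ζ) * J = J * ev J (stem g ζ) := fun J hJ => by
    obtain ⟨u, v, huv⟩ := hg.2 J hJ ζ.re ζ.im ((pt_mem_ball hJ).2 hζ)
    rw [← hg.1.eq_ev_stem hJ hζ, slice_apply, huv, pt_mul_comm]
  -- Both `a + J b` and `a - J b` commute with `J`, hence so do `a` and `J b` separately, and then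
  -- `b`.
  have hAB : ∀ J ∈ imagUnits, rePart (stem g ζ) * J = J * rePart (stem g ζ) ∧
      imPart (stem g ζ) * J = J * imPart (stem g ζ) := by
    intro J hJ
    have h1 := hcomm J hJ
    have h2 := hcomm (-J) (neg_mem_imagUnits hJ)
    rw [ev] at h1 h2
    generalize rePart (stem g ζ) = a at *
    generalize imPart (stem g ζ) = b at *
    have h3 : a * J = J * a := by
      have : (2 : ℝ) • (a * J) = (2 : ℝ) • (J * a) := by
        rw [two_smul, two_smul]
        calc a * J + a * J = (a + J * b) * J - (a + -J * b) * -J := by noncomm_ring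
          _ = J * (a + J * b) - -J * (a + -J * b) := by rw [h1, h2]
          _ = _ := by noncomm_ring
      exact smul_right_injective _ (two_ne_zero (α := ℝ)) this
    refine ⟨h3, ?_⟩
    rw [add_mul, mul_add, h3, add_right_inj, mul_assoc] at h1
    have hJ0 : J ≠ 0 := by rintro rfl; simpa using hJ.2
    exact mul_left_cancel₀ hJ0 h1
  have ha := eq_coe_of_commute fun J hJ => (hAB J hJ).1
  have hb := eq_coe_of_commute fun J hJ => (hAB J hJ).2
  conv_lhs => rw [← cx_rePart_imPart (stem g ζ), ha, hb]
  ext <;> apply Complex.ext <;> simp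

lemma continuousOn_cf_stem (hgc : ContinuousOn g (closedBall 0 R)) (k : Fin 4) :
    ContinuousOn (fun z => cf k (stem g z)) (closedBall 0 R) := by
  simp only [cf_stem]
  have h1 : ContinuousOn (fun z => g (slice unitI z)) (closedBall 0 R) :=
    hgc.comp (slice unitI).continuous.continuousOn fun z hz => by
      simpa [norm_slice unitI_mem] using hz
  have h2 : ContinuousOn (fun z => g (slice unitI (starRingEnd ℂ z))) (closedBall 0 R) :=
    h1.comp Complex.continuous_conj.continuousOn fun z hz => by simpa using hz
  exact ((cform unitI k).continuous.comp_continuousOn h1).add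
    (Complex.continuous_conj.comp_continuousOn
      ((cform unitI k).continuous.comp_continuousOn h2))

/-- The integrals live on `|q| = R`, where `g` is only continuous; the identity passes from the open
to the closed disc by continuity. -/
lemma IntrinsicOn.slice_eq (hg : IntrinsicOn g (ball 0 R)) (hR : R ≠ 0)
    (hgc : ContinuousOn g (closedBall 0 R)) {J : ℍ[ℝ]} (hJ : J ∈ imagUnits) {z : ℂ}
    (hz : z ∈ closedBall (0 : ℂ) R) : g (slice J z) = slice J (stem g z).re := by
  have h1 : Set.EqOn (fun z => g (slice J z)) (fun z => slice J (stem g z).re) (ball 0 R) := by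
    intro z hz
    simp only
    rw [hg.1.eq_ev_stem hJ hz, hg.stem_eq hz, ev_coe, slice_apply]
    simp
  refine h1.of_subset_closure (t := closedBall 0 R) ?_ ?_ ball_subset_closedBall ?_ hz
  · exact hgc.comp (slice J).continuous.continuousOn fun z hz => by
      simpa [norm_slice hJ] using hz
  · exact (slice J).continuous.comp_continuousOn (continuousOn_cf_stem hgc 0)
  · rw [closure_ball 0 hR]

/-- An intrinsic factor has a scalar stem function, so pointwise multiplication by it multiplies
stem functions, and `normSq` squares the scalar. On the boundary only the values at conjugate points
are used. -/
lemma stemNorm_mul_of_intrinsic (hg : IntrinsicOn g (ball 0 R)) (hR : R ≠ 0)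
    (hgc : ContinuousOn g (closedBall 0 R))
    (hfgh : ∀ q ∈ closedBall (0 : ℍ[ℝ]) R, f q = g q * h q) {z : ℂ}
    (hz : z ∈ closedBall (0 : ℂ) R) :
    stemNorm f z = (stem g z).re ^ 2 * stemNorm h z := by
  have hmem : ∀ J ∈ imagUnits, slice J z ∈ closedBall (0 : ℍ[ℝ]) R := fun J hJ => by
    simpa [norm_slice hJ] using hz
  have h0 := neg_mem_imagUnits unitI_mem
  have e : stem f z = ((stem g z).re : ℍ[ℂ]) * stem h z := by
    rw [← stem_mul_of_slice (P := g) (g := h)]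
    · apply stem_congr
      · rw [← slice_apply]; exact hfgh _ (hmem _ unitI_mem)
      · rw [pt_neg_right, ← slice_apply]; exact hfgh _ (hmem _ h0)
    · rw [← slice_apply, hg.slice_eq hR hgc unitI_mem hz, slice_apply]
    · rw [pt_neg_right, pt_neg_right, ← slice_apply, hg.slice_eq hR hgc h0 hz, slice_apply]
  rw [stemNorm, e, map_mul, Quaternion.normSq_coe]; rfl

/-- Nothing is known about `a` and `b` separately beyond continuity. From above, `log x ≤ x` bounds
both logarithms; from below, `2 log a = F - log b ≥ -|F| - b`. So the sum being integrable suffices.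
-/
lemma intervalIntegrable_log_of_add {a b F : ℝ → ℝ} {s t : ℝ} (ha : Continuous a)
    (hb : Continuous b) (ha0 : ∀ x, 0 ≤ a x) (hb0 : ∀ x, 0 ≤ b x)
    (hF : IntervalIntegrable F volume s t)
    (h : ∀ᵐ x, F x = 2 * Real.log (a x) + Real.log (b x)) :
    IntervalIntegrable (fun x => Real.log (a x)) volume s t ∧
    IntervalIntegrable (fun x => Real.log (b x)) volume s t := by
  have h1 : IntervalIntegrable (fun x => Real.log (a x)) volume s t := by
    refine IntervalIntegrable.mono_fun' (g := fun x => a x + |F x| + b x)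
      (((ha.intervalIntegrable _ _).add hF.abs).add (hb.intervalIntegrable _ _))
      (Real.measurable_log.comp ha.measurable).aestronglyMeasurable ?_
    filter_upwards [ae_restrict_of_ae h] with x hx
    have h2 := Real.log_le_self (ha0 x)
    have h3 := Real.log_le_self (hb0 x)
    have h4 := neg_abs_le (F x)
    have h5 := abs_nonneg (F x)
    have h6 := ha0 x
    have h7 := hb0 x
    rw [Real.norm_eq_abs, abs_le]
    constructor <;> linarith
  refine ⟨h1, (hF.sub (h1.const_mul 2)).congr_ae ?_⟩
  filter_upwards [ae_restrict_of_ae h] with x hx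
  rw [hx]; ring

lemma SliceRegularOn.finite_zeros_stemNorm (hRr : R < r)
    (hf : SliceRegularOn f (ball 0 r)) (hf0 : f 0 ≠ 0) :
    {z ∈ closedBall (0 : ℂ) R | stemNorm f z = 0}.Finite := by
  have hsub : closedBall (0 : ℂ) R ⊆ ball 0 r := closedBall_subset_ball hRr
  have ha : AnalyticOnNhd ℂ (stemNorm f) (closedBall 0 R) := fun z hz =>
    hf.analyticAt_stemNorm (hsub hz)
  refine ((MeromorphicOn.divisor (stemNorm f) (closedBall 0 R)).finiteSupport
    (isCompact_closedBall 0 R)).subset ?_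
  rintro z ⟨hz, hz0⟩
  rw [Function.mem_support, MeromorphicOn.AnalyticOnNhd.divisor_apply ha hz]
  have h1 := (ha z hz).analyticOrderAt_ne_zero.2 hz0
  obtain ⟨n, hn⟩ := ENat.ne_top_iff_exists.1 (hf.analyticOrderAt_ne_top hf0 (hsub hz))
  rw [← hn] at h1 ⊢
  simpa using h1

lemma circlePt_eq_slice (I : ℍ[ℝ]) (R θ : ℝ) : circlePt I R θ = slice I (circleMap 0 R θ) := by
  rw [circlePt, slice_apply, circleMap_zero_re, circleMap_zero_im]

end SliceRegular

end

/-! ### The Jensen theorem -/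

theorem mainTheorem2 (R : ℝ) (hR : 0 < R) (U : Set ℍ[ℝ]) (hU : IsOpen U)
    (hRU : Metric.closedBall (0 : ℍ[ℝ]) R ⊆ U)
    (f g h : ℍ[ℝ] → ℍ[ℝ]) (hf : SliceRegular.SliceRegularOn f U) (hf0 : f 0 ≠ 0)
    (hg : SliceRegular.IntrinsicOn g (Metric.ball 0 R))
    (hgc : ContinuousOn g (Metric.closedBall 0 R))
    (hgz : SliceRegular.OnlySphericalZeros g (Metric.ball 0 R))
    (hh : SliceRegular.SliceRegularOn h (Metric.ball 0 R))
    (hhc : ContinuousOn h (Metric.closedBall 0 R))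
    (hhz : SliceRegular.OnlyIsolatedZeros h (Metric.ball 0 R))
    (hfgh : ∀ q ∈ Metric.ball (0 : ℍ[ℝ]) R, f q = g q * h q)
    (I : ℍ[ℝ]) (hI : I ∈ SliceRegular.imagUnits) :
    IntervalIntegrable (fun t => (SliceRegular.zeroCount f R t : ℝ) / t)
      MeasureTheory.volume 0 R ∧
    IntervalIntegrable (fun θ => Real.log ‖g (SliceRegular.circlePt I R θ)‖)
      MeasureTheory.volume 0 (2 * Real.pi) ∧
    IntervalIntegrable
      (fun θ => Real.log ‖SliceRegular.symm h (SliceRegular.circlePt I R θ)‖)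
      MeasureTheory.volume 0 (2 * Real.pi) ∧
    ∫ t in (0 : ℝ)..R, (SliceRegular.zeroCount f R t : ℝ) / t =
      ((1 / (2 * Real.pi)) *
          (∫ θ in (0 : ℝ)..(2 * Real.pi), Real.log ‖g (SliceRegular.circlePt I R θ)‖) -
        Real.log ‖g 0‖) +
      (1 / 2) * ((1 / (2 * Real.pi)) *
          (∫ θ in (0 : ℝ)..(2 * Real.pi),
            Real.log ‖SliceRegular.symm h (SliceRegular.circlePt I R θ)‖) -
        Real.log ‖SliceRegular.symm h 0‖) := by
  open SliceRegular Metric MeasureTheory in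
  -- Compactness of the closed ball gives a larger concentric ball on which `f` is regular, so that
  -- the norm form of `f` is analytic across the circle.
  obtain ⟨δ, hδ, hδU⟩ := (isCompact_closedBall (0 : ℍ[ℝ]) R).exists_thickening_subset_open hU hRU
  rw [thickening_closedBall hδ hR.le] at hδU
  have hRr : R < δ + R := by linarith
  have hfr : SliceRegularOn f (ball 0 (δ + R)) :=
    ⟨hf.1.mono hδU, fun J hJ x y hxy => hf.2 J hJ x y (hδU hxy)⟩
  have hfgh' : ∀ q ∈ closedBall (0 : ℍ[ℝ]) R, f q = g q * h q := by
    have : Set.EqOn f (fun q => g q * h q) (ball 0 R) := hfgh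
    refine this.of_subset_closure (t := closedBall 0 R) (hf.1.continuousOn.mono hRU)
      (hgc.mul hhc) ball_subset_closedBall ?_
    rw [closure_ball 0 hR.ne']
  have hN : ∀ z ∈ closedBall (0 : ℂ) R,
      stemNorm f z = (stem g z).re ^ 2 * stemNorm h z := fun z hz =>
    stemNorm_mul_of_intrinsic hg hR.ne' hgc hfgh' hz
  have hgn : ∀ z ∈ closedBall (0 : ℂ) R, ‖g (slice I z)‖ = ‖(stem g z).re‖ := fun z hz => by
    rw [hg.slice_eq hR.ne' hgc hI hz, norm_slice hI]
  have hsn : ∀ z : ℂ, ‖symm h (slice I z)‖ = ‖stemNorm h z‖ := fun z => by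
    rw [slice_apply, norm_symm_pt h hI]
  have hlog : ∀ z ∈ closedBall (0 : ℂ) R, stemNorm f z ≠ 0 → Real.log ‖stemNorm f z‖ =
      2 * Real.log ‖g (slice I z)‖ + Real.log ‖symm h (slice I z)‖ := by
    intro z hz h0
    rw [hgn z hz, hsn]
    rw [hN z hz] at h0 ⊢
    have h1 := left_ne_zero_of_mul h0
    rw [norm_mul, Real.log_mul (norm_ne_zero_iff.2 h1)
      (norm_ne_zero_iff.2 (right_ne_zero_of_mul h0)), norm_pow, Real.log_pow]
    norm_num
  have hcm : ∀ θ, circleMap 0 R θ ∈ closedBall (0 : ℂ) R := fun θ =>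
    circleMap_mem_closedBall 0 hR.le θ
  -- The logarithm of the product may fail to split at zeros of the norm form, since `Real.log 0 =
  -- 0`; there are finitely many in the closed disc, so they are met for a null set of `θ`.
  have hae : ∀ᵐ θ : ℝ, Real.log ‖stemNorm f (circleMap 0 R θ)‖ =
      2 * Real.log ‖g (circlePt I R θ)‖ + Real.log ‖symm h (circlePt I R θ)‖ := by
    have h0 := ((hfr.finite_zeros_stemNorm hRr hf0).countable.preimage_circleMap 0
      hR.ne').measure_zero volume
    filter_upwards [measure_eq_zero_iff_ae_notMem.1 h0] with θ hθ
    rw [circlePt_eq_slice]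
    exact hlog _ (hcm θ) fun h1 => hθ ⟨hcm θ, h1⟩
  have hcg : Continuous fun θ => ‖g (circlePt I R θ)‖ := by
    simp only [circlePt_eq_slice]
    exact (hgc.comp_continuous ((slice I).continuous.comp (continuous_circleMap 0 R))
      fun θ => by simpa [norm_slice hI] using hcm θ).norm
  have hch : Continuous fun θ => ‖symm h (circlePt I R θ)‖ := by
    simp only [circlePt_eq_slice, hsn, stemNorm, Quaternion.normSq_def']
    have hk : ∀ k, Continuous fun θ => cf k (stem h (circleMap 0 R θ)) := fun k =>
      (continuousOn_cf_stem hhc k).comp_continuous (continuous_circleMap 0 R) hcm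
    exact (((((hk 0).pow 2).add ((hk 1).pow 2)).add ((hk 2).pow 2)).add ((hk 3).pow 2)).norm
  have hFi : IntervalIntegrable (fun θ => Real.log ‖stemNorm f (circleMap 0 R θ)‖) volume 0
      (2 * Real.pi) := by
    refine MeromorphicOn.circleIntegrable_log_norm (f := stemNorm f) (c := 0) (R := R)
      fun z hz => ?_
    refine (hfr.analyticAt_stemNorm ?_).meromorphicAt
    rw [abs_of_pos hR] at hz
    exact closedBall_subset_ball hRr (sphere_subset_closedBall hz)
  obtain ⟨hGi, hHi⟩ := intervalIntegrable_log_of_add hcg hch (fun _ => norm_nonneg _)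
    (fun _ => norm_nonneg _) hFi hae
  obtain ⟨hci, hJ⟩ := hfr.integral_zeroCount hR hRr hf0
  refine ⟨hci, hGi, hHi, ?_⟩
  have hN0 : stemNorm f 0 ≠ 0 := by
    have h1 := (stemNorm_real f 0).1
    rw [Complex.ofReal_zero, Quaternion.coe_zero] at h1
    rw [h1, Complex.ofReal_ne_zero]; exact pow_ne_zero _ (norm_ne_zero_iff.2 hf0)
  -- The same splitting at the centre, where `N(0) = |f(0)|² ≠ 0`, produces the two constant terms.
  have h0 := hlog 0 (mem_closedBall_self hR.le) hN0
  rw [map_zero] at h0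
  rw [hJ, h0, Real.circleAverage_def, intervalIntegral.integral_congr_ae (hae.mono fun θ hθ _ => hθ),
    intervalIntegral.integral_add (hGi.const_mul 2) hHi, intervalIntegral.integral_const_mul,
    smul_eq_mul, one_div]
  ring
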